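/- Let $\mathbb K$ be a field of characteristic $0$. For $n\ge 0$ let $$\Omega_n=\frac{\mathbb K[x_0,\dots,x_n,dx_0,\dots,dx_n]}{\left(\sum_i x_i-1,\ \sum_i dx_i\right)}$$ be the graded-commutative algebra of polynomial differential forms on the affine standard simplex $\Delta^n=\{(x_0,\dots,x_n)\in\mathbb K^{n+1}: \sum_i x_i=1\}$ with vertices $e_0,\dots,e_n$ ($x_i$ has degree $0$, $dx_i$ has degree $1$). Let $\int_{\Delta^n}\colon\Omega_n\to\mathbb K$ be the linear map that vanishes on forms of degree $\ne n$ and satisfies $$\int_{\Delta^n}x_0^{k_0}\cdots x_n^{k_n}\,dx_0\wedge\dots\wedge\widehat{dx_i}\wedge\dots\wedge dx_n=(-1)^i\frac{k_0!\cdots k_n!}{(k_0+\dots+k_n+n)!}.$$ Let $\widehat\Delta^n$ be the $(n+1)$-dimensional affine standard simplex with coordinates written, in this order, $(s,t_0,\dots,t_n)$, and let $\widehat\Omega_n$ be its algebra of polynomial forms, with $\int_{\widehat\Delta^n}\colon\widehat\Omega_n\to\mathbb K$ as above. Forms on a product are identified with the graded tensor product of the algebras of forms on the factors. Fix $m\ge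 0$, let $I(n,m)$ be the set of strictly increasing maps $f\colon\{0,\dots,n\}\to\{0,\dots,m\}$, and for $f\in I(n,m)$ put $$\omega_f=n!\sum_{i=0}^n(-1)^i x_{f(i)}\,dx_{f(0)}\wedge\dots\wedge\widehat{dx_{f(i)}}\wedge\dots\wedge dx_{f(n)}\in\Omega_m .$$ Dupont's operator. For $0\le j\le m$ and $\eta\in\Omega_m$, let $ds\wedge\alpha_\eta+\beta_\eta$ with $\alpha_\eta,\beta_\eta\in\Omega_m[s]$ be the pull-back of $\eta$ along $\widehat\Delta^0\times\Delta^m\to\Delta^m$, $((s,t_0),v)\mapsto s e_j+t_0v=se_j+(1-s)v$, and let $h_{(j)}(\eta)=\int_0^1\alpha_\eta\,ds\in\Omega_m$ (integration of the coefficients, polynomials in $s$, so that $s^k\mapsto 1/(k+1)$). For $f\in I(n,m)$ let $h_f=h_{(f(n))}\circ\dots\circ h_{(f(0))}$, and let $$h_m(\eta)=\sum_{n=0}^m\sum_{f\in I(n,m)}\omega_f\wedge h_f(\eta).$$ Manetti's operator. For $f\in I(n,m)$ let $\widehat f\colon\widehat\Delta^n\times\Delta^m\to\Delta^m$, $((s,t_0,\dots,t_n),v)\mapsto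 sv+\sum_{i=0}^n t_ie_{f(i)}$, let $k_f$ be the composition $$\Omega_m\xrightarrow{\ \widehat f^{*}\ }\widehat\Omega_n\otimes\Omega_m\xrightarrow{\ \int_{\widehat\Delta^n}\otimes\,\mathrm{Id}\ }\Omega_m,$$ and let $$k_m(\eta)=\sum_{n=0}^m\sum_{f\in I(n,m)}\omega_f\wedge k_f(\eta).$$ Theorem. For every $m\in\mathbb N$, $k_m=h_m$ as linear maps $\Omega_m\to\Omega_m$. -/

import Mathlib

noncomputable section

open scoped TensorProduct DirectSum

namespace SimplexForms

/-- The relations between the generators `xᵢ` (written `.inl i`) and `dxᵢ` (written `.inr i`) of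
the algebra of polynomial forms on the standard `n`-simplex: graded commutativity, with `xᵢ` in
degree `0` and `dxᵢ` in degree `1` (in characteristic zero `dxᵢ dxᵢ = -dxᵢ dxᵢ` gives
`dxᵢ dxᵢ = 0`), and `∑ xᵢ = 1`, `∑ dxᵢ = 0`. -/
inductive Rel (K : Type*) [Field K] (n : ℕ) :
    FreeAlgebra K (Fin (n + 1) ⊕ Fin (n + 1)) → FreeAlgebra K (Fin (n + 1) ⊕ Fin (n + 1)) → Prop
  | x_comm (i j : Fin (n + 1)) :
      Rel K n (FreeAlgebra.ι K (.inl i) * FreeAlgebra.ι K (.inl j))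
        (FreeAlgebra.ι K (.inl j) * FreeAlgebra.ι K (.inl i))
  | x_dx_comm (i j : Fin (n + 1)) :
      Rel K n (FreeAlgebra.ι K (.inl i) * FreeAlgebra.ι K (.inr j))
        (FreeAlgebra.ι K (.inr j) * FreeAlgebra.ι K (.inl i))
  | dx_anticomm (i j : Fin (n + 1)) :
      Rel K n (FreeAlgebra.ι K (.inr i) * FreeAlgebra.ι K (.inr j))
        (-(FreeAlgebra.ι K (.inr j) * FreeAlgebra.ι K (.inr i)))
  | sum_x : Rel K n (∑ i, FreeAlgebra.ι K (.inl i)) 1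
  | sum_dx : Rel K n (∑ i, FreeAlgebra.ι K (.inr i)) 0

/-- The algebra `Ω_n = K[x₀, …, xₙ, dx₀, …, dxₙ] / (∑ xᵢ - 1, ∑ dxᵢ)` of polynomial differential
forms on the affine standard `n`-simplex. The product is the wedge product. -/
def Omega (K : Type*) [Field K] (n : ℕ) : Type _ := RingQuot (Rel K n)

instance (K : Type*) [Field K] (n : ℕ) : Ring (Omega K n) :=
  inferInstanceAs (Ring (RingQuot (Rel K n)))

instance (K : Type*) [Field K] (n : ℕ) : Algebra K (Omega K n) :=
  inferInstanceAs (Algebra K (RingQuot (Rel K n)))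

/-- The quotient map from the free algebra. -/
def mk (K : Type*) [Field K] (n : ℕ) :
    FreeAlgebra K (Fin (n + 1) ⊕ Fin (n + 1)) →ₐ[K] Omega K n :=
  RingQuot.mkAlgHom K (Rel K n)

theorem mk_rel {K : Type*} [Field K] {n : ℕ} {a b} (h : Rel K n a b) : mk K n a = mk K n b :=
  RingQuot.mkAlgHom_rel K h

variable {K : Type*} [Field K] {n : ℕ}

/-- The generators: `.inl i` gives `xᵢ`, `.inr i` gives `dxᵢ`. -/
def gen (a : Fin (n + 1) ⊕ Fin (n + 1)) : Omega K n :=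
  mk K n (FreeAlgebra.ι K a)

/-- The coordinate function `xᵢ`. -/
def x (i : Fin (n + 1)) : Omega K n := gen (.inl i)

/-- The differential `dxᵢ`. -/
def dx (i : Fin (n + 1)) : Omega K n := gen (.inr i)

theorem x_comm (i j : Fin (n + 1)) : (x i * x j : Omega K n) = x j * x i := by
  have h := mk_rel (Rel.x_comm (K := K) i j)
  simp only [map_mul] at h
  exact h

theorem x_dx_comm (i j : Fin (n + 1)) : (x i * dx j : Omega K n) = dx j * x i := by
  have h := mk_rel (Rel.x_dx_comm (K := K) i j)
  simp only [map_mul] at h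
  exact h

theorem dx_anticomm (i j : Fin (n + 1)) : (dx i * dx j : Omega K n) = -(dx j * dx i) := by
  have h := mk_rel (Rel.dx_anticomm (K := K) i j)
  simp only [map_mul, map_neg] at h
  exact h

theorem sum_x : (∑ i, x i : Omega K n) = 1 := by
  have h := mk_rel (Rel.sum_x (K := K) (n := n))
  simp only [map_sum, map_one] at h
  exact h

theorem sum_dx : (∑ i, dx i : Omega K n) = 0 := by
  have h := mk_rel (Rel.sum_dx (K := K) (n := n))
  simp only [map_sum, map_zero] at h
  exact h

/-- The algebra map out of `Ω_n` with prescribed values on the generators. -/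
def lift {B : Type*} [Ring B] [Algebra K B] (X D : Fin (n + 1) → B)
    (h₁ : ∀ i j, X i * X j = X j * X i) (h₂ : ∀ i j, X i * D j = D j * X i)
    (h₃ : ∀ i j, D i * D j = -(D j * D i)) (h₄ : ∑ i, X i = 1) (h₅ : ∑ i, D i = 0) :
    Omega K n →ₐ[K] B :=
  RingQuot.liftAlgHom K ⟨FreeAlgebra.lift K (Sum.elim X D), by
    intro a b h
    cases h with
    | x_comm i j => simpa using h₁ i j
    | x_dx_comm i j => simpa using h₂ i j
    | dx_anticomm i j => simpa using h₃ i j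
    | sum_x => simpa using h₄
    | sum_dx => simpa using h₅⟩

section

variable {B : Type*} [Ring B] [Algebra K B] (X D : Fin (n + 1) → B)
    (h₁ : ∀ i j, X i * X j = X j * X i) (h₂ : ∀ i j, X i * D j = D j * X i)
    (h₃ : ∀ i j, D i * D j = -(D j * D i)) (h₄ : ∑ i, X i = 1) (h₅ : ∑ i, D i = 0)

theorem lift_gen (a : Fin (n + 1) ⊕ Fin (n + 1)) :
    lift X D h₁ h₂ h₃ h₄ h₅ (gen a : Omega K n) = Sum.elim X D a := by
  rw [lift, gen]
  exact (RingQuot.liftAlgHom_mkAlgHom_apply K _ _ _).trans (by simp)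

theorem lift_x (i : Fin (n + 1)) : lift X D h₁ h₂ h₃ h₄ h₅ (x i : Omega K n) = X i :=
  lift_gen X D h₁ h₂ h₃ h₄ h₅ _

theorem lift_dx (i : Fin (n + 1)) : lift X D h₁ h₂ h₃ h₄ h₅ (dx i : Omega K n) = D i :=
  lift_gen X D h₁ h₂ h₃ h₄ h₅ _

end

theorem algHom_ext {B : Type*} [Ring B] [Algebra K B] {φ ψ : Omega K n →ₐ[K] B}
    (h : ∀ a, φ (gen a) = ψ (gen a)) : φ = ψ := by
  apply RingQuot.ringQuot_ext'
  apply FreeAlgebra.hom_ext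
  funext a
  exact h a

variable (K n) in
/-- The space `Ω_n^p` of `p`-forms, spanned by the products of generators
with exactly `p` factors of the form `dxᵢ`. -/
def degreePart (p : ℕ) : Submodule K (Omega K n) :=
  Submodule.span K {ω | ∃ w : List (Fin (n + 1) ⊕ Fin (n + 1)),
    w.countP Sum.isRight = p ∧ (w.map gen).prod = ω}

theorem word_mem (w : List (Fin (n + 1) ⊕ Fin (n + 1))) :
    (w.map gen).prod ∈ degreePart K n (w.countP Sum.isRight) :=
  Submodule.subset_span ⟨w, rfl, rfl⟩

theorem x_mem (i : Fin (n + 1)) : x i ∈ degreePart K n 0 :=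
  Submodule.subset_span ⟨[.inl i], by simp, by simp [x]⟩

theorem dx_mem (i : Fin (n + 1)) : dx i ∈ degreePart K n 1 :=
  Submodule.subset_span ⟨[.inr i], by simp, by simp [dx]⟩

instance : SetLike.GradedMonoid (degreePart K n) where
  one_mem := Submodule.subset_span ⟨[], by simp, by simp⟩
  mul_mem := by
    intro p q a b ha hb
    have key : degreePart K n p * degreePart K n q ≤ degreePart K n (p + q) := by
      rw [degreePart, degreePart, Submodule.span_mul_span, Submodule.span_le]
      rintro _ ⟨_, ⟨v, hv, rfl⟩, _, ⟨w, hw, rfl⟩, rfl⟩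
      exact Submodule.subset_span ⟨v ++ w, by simp [hv, hw], by simp⟩
    exact key (Submodule.mul_mem_mul ha hb)

/-- The decomposition of a form into its homogeneous components. -/
def decomposeHom : Omega K n →ₐ[K] ⨁ p, degreePart K n p :=
  lift (fun i => DirectSum.of (fun p => degreePart K n p) 0 ⟨x i, x_mem i⟩)
    (fun i => DirectSum.of (fun p => degreePart K n p) 1 ⟨dx i, dx_mem i⟩)
    (fun i j => by
      rw [DirectSum.of_mul_of, DirectSum.of_mul_of]
      exact DirectSum.of_eq_of_gradedMonoid_eq (Sigma.subtype_ext rfl (x_comm i j)))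
    (fun i j => by
      rw [DirectSum.of_mul_of, DirectSum.of_mul_of]
      exact DirectSum.of_eq_of_gradedMonoid_eq (Sigma.subtype_ext rfl (x_dx_comm i j)))
    (fun i j => by
      rw [DirectSum.of_mul_of, DirectSum.of_mul_of, ← map_neg]
      exact DirectSum.of_eq_of_gradedMonoid_eq (Sigma.subtype_ext rfl (dx_anticomm i j)))
    (by
      rw [← map_sum]
      exact DirectSum.of_eq_of_gradedMonoid_eq (Sigma.subtype_ext rfl (by
        exact (AddSubmonoidClass.coe_finsetSum _ _).trans sum_x)))
    (by
      rw [← map_sum, ← map_zero (DirectSum.of (fun p => degreePart K n p) 1)]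
      exact DirectSum.of_eq_of_gradedMonoid_eq (Sigma.subtype_ext rfl (by
        exact (AddSubmonoidClass.coe_finsetSum _ _).trans sum_dx)))

theorem decomposeHom_gen (a : Fin (n + 1) ⊕ Fin (n + 1)) (p : ℕ) (h : gen a ∈ degreePart K n p)
    (hp : p = [a].countP Sum.isRight) :
    decomposeHom (gen a : Omega K n) = DirectSum.of (fun p => degreePart K n p) p ⟨gen a, h⟩ := by
  subst hp
  rw [decomposeHom, lift_gen]
  cases a <;> rfl

theorem decomposeHom_word (w : List (Fin (n + 1) ⊕ Fin (n + 1))) :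
    decomposeHom ((w.map gen).prod : Omega K n) =
      DirectSum.of (fun p => degreePart K n p) _ ⟨_, word_mem w⟩ := by
  induction w with
  | nil => simp only [List.map_nil, List.prod_nil, map_one]; rfl
  | cons a w ih =>
    have ha : gen a ∈ degreePart K n ([a].countP Sum.isRight) := by
      simpa using word_mem (K := K) [a]
    simp only [List.map_cons, List.prod_cons, map_mul]
    rw [ih, decomposeHom_gen a _ ha rfl, DirectSum.of_mul_of]
    refine DirectSum.of_eq_of_gradedMonoid_eq (Sigma.subtype_ext ?_ rfl)
    change _ + _ = List.countP _ ([a] ++ w)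
    rw [List.countP_append]

/-- `Ω_n` is graded by the degree of forms. -/
instance : GradedAlgebra (degreePart K n) :=
  GradedAlgebra.ofAlgHom _ decomposeHom
    (algHom_ext fun a => by
      have ha : gen a ∈ degreePart K n ([a].countP Sum.isRight) := by
        simpa using word_mem (K := K) [a]
      rw [AlgHom.comp_apply, decomposeHom_gen a _ ha rfl, DirectSum.coeAlgHom_of]
      rfl)
    (by
      rintro p ⟨ω, hω⟩
      induction hω using Submodule.span_induction with
      | mem ω h =>
        obtain ⟨w, rfl, rfl⟩ := h
        exact decomposeHom_word w
      | zero =>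
        rw [map_zero]; exact (map_zero _).symm
      | add a b ha hb iha ihb =>
        change decomposeHom (a + b) = _
        rw [map_add, iha, ihb, ← map_add]; rfl
      | smul c a ha iha =>
        change decomposeHom (c • a) = _
        rw [map_smul, iha]
        exact ((DirectSum.lof K ℕ (fun p => degreePart K n p) p).map_smul c _).symm)


variable {N m : ℕ}

/-- Let `P(v)` be the point `v` of the `m`-simplex if `P = none`, and the vertex `e_j` if
`P = some j`. This is the `i`-th coordinate of `P(v)`, as a function of `v`. -/
def pointCoord (P : Option (Fin (m + 1))) (i : Fin (m + 1)) : Omega K m :=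
  P.elim (x i) fun j => if i = j then 1 else 0

/-- The differential of the `i`-th coordinate of `P(v)`. -/
def pointDiff (P : Option (Fin (m + 1))) (i : Fin (m + 1)) : Omega K m :=
  P.elim (dx i) fun _ => 0

theorem pointCoord_mem (P : Option (Fin (m + 1))) (i : Fin (m + 1)) :
    pointCoord P i ∈ degreePart K m 0 := by
  cases P with
  | none => exact x_mem i
  | some j =>
    simp only [pointCoord, Option.elim_some]
    split_ifs
    · exact SetLike.GradedOne.one_mem
    · exact Submodule.zero_mem _

theorem pointDiff_mem (P : Option (Fin (m + 1))) (i : Fin (m + 1)) :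
    pointDiff P i ∈ degreePart K m 1 := by
  cases P with
  | none => exact dx_mem i
  | some j => exact Submodule.zero_mem _

theorem pointCoord_comm (P Q : Option (Fin (m + 1))) (i j : Fin (m + 1)) :
    (pointCoord P i * pointCoord Q j : Omega K m) = pointCoord Q j * pointCoord P i := by
  cases P with
  | none => cases Q <;> simp [pointCoord, x_comm i j]
  | some a => simp only [pointCoord, Option.elim_some]; split_ifs <;> simp

theorem pointCoord_pointDiff_comm (P Q : Option (Fin (m + 1))) (i j : Fin (m + 1)) :
    (pointCoord P i * pointDiff Q j : Omega K m) = pointDiff Q j * pointCoord P i := by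
  cases P <;> cases Q <;> simp [pointCoord, pointDiff, x_dx_comm i j]

theorem pointDiff_anticomm (P Q : Option (Fin (m + 1))) (i j : Fin (m + 1)) :
    (pointDiff P i * pointDiff Q j : Omega K m) = -(pointDiff Q j * pointDiff P i) := by
  cases P <;> cases Q <;> simp [pointDiff, dx_anticomm i j]

theorem sum_pointCoord (P : Option (Fin (m + 1))) : (∑ i, pointCoord P i : Omega K m) = 1 := by
  cases P with
  | none => exact sum_x
  | some j => simp [pointCoord]

theorem sum_pointDiff (P : Option (Fin (m + 1))) : (∑ i, pointDiff P i : Omega K m) = 0 := by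
  cases P with
  | none => exact sum_dx
  | some j => simp [pointDiff]

variable (K N m) in
/-- The tensor product `Ω_N ⊗ Ω_m` of graded algebras, that is, the polynomial forms on the product
of the two simplices: `(a ⊗ b)(a' ⊗ b') = (-1)^(deg b * deg a') (a a') ⊗ (b b')`. -/
abbrev ProdForms : Type _ := degreePart K N ᵍ⊗[K] degreePart K m

theorem tmul_mul_tmul {p q : ℕ} (a a' : Omega K N) (b b' : Omega K m)
    (hb : b ∈ degreePart K m p) (ha' : a' ∈ degreePart K N q) :
    (a ᵍ⊗ₜ[K] b * a' ᵍ⊗ₜ[K] b' : ProdForms K N m) =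
      (-1 : ℤˣ) ^ (p * q) • ((a * a') ᵍ⊗ₜ[K] (b * b')) :=
  GradedTensorProduct.tmul_coe_mul_coe_tmul (degreePart K N) (degreePart K m) a ⟨b, hb⟩ ⟨a', ha'⟩ b'

/-- The `i`-th coordinate of `∑ₐ yₐ Pₐ(v)`, as a function of `(y, v)` in the product of the
`N`-simplex and the `m`-simplex. -/
def joinCoord (P : Fin (N + 1) → Option (Fin (m + 1))) (i : Fin (m + 1)) : ProdForms K N m :=
  ∑ a, x a ᵍ⊗ₜ[K] pointCoord (P a) i

/-- The differential of `joinCoord P i`, by the Leibniz rule. -/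
def joinDiff (P : Fin (N + 1) → Option (Fin (m + 1))) (i : Fin (m + 1)) : ProdForms K N m :=
  ∑ a, (dx a ᵍ⊗ₜ[K] pointCoord (P a) i + x a ᵍ⊗ₜ[K] pointDiff (P a) i)

theorem neg_tmul' (a : Omega K N) (b : Omega K m) :
    ((-a) ᵍ⊗ₜ[K] b : ProdForms K N m) = -(a ᵍ⊗ₜ[K] b) := by
  rw [GradedTensorProduct.tmul, TensorProduct.neg_tmul, map_neg]

theorem tmul_neg' (a : Omega K N) (b : Omega K m) :
    (a ᵍ⊗ₜ[K] (-b) : ProdForms K N m) = -(a ᵍ⊗ₜ[K] b) := by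
  rw [GradedTensorProduct.tmul, TensorProduct.tmul_neg, map_neg]

theorem joinCoord_comm (P : Fin (N + 1) → Option (Fin (m + 1))) (i j : Fin (m + 1)) :
    (joinCoord P i * joinCoord P j : ProdForms K N m) = joinCoord P j * joinCoord P i := by
  refine Commute.sum_left _ _ _ fun a _ => Commute.sum_right _ _ _ fun b _ => ?_
  rw [Commute, SemiconjBy, tmul_mul_tmul _ _ _ _ (pointCoord_mem _ _) (x_mem _),
    tmul_mul_tmul _ _ _ _ (pointCoord_mem _ _) (x_mem _), x_comm, pointCoord_comm]

theorem joinCoord_joinDiff_comm (P : Fin (N + 1) → Option (Fin (m + 1))) (i j : Fin (m + 1)) :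
    (joinCoord P i * joinDiff P j : ProdForms K N m) = joinDiff P j * joinCoord P i := by
  refine Commute.sum_left _ _ _ fun a _ => Commute.sum_right _ _ _ fun b _ => ?_
  refine Commute.add_right ?_ ?_
  · rw [Commute, SemiconjBy, tmul_mul_tmul _ _ _ _ (pointCoord_mem _ _) (dx_mem _),
      tmul_mul_tmul _ _ _ _ (pointCoord_mem _ _) (x_mem _), x_dx_comm, pointCoord_comm]
  · rw [Commute, SemiconjBy, tmul_mul_tmul _ _ _ _ (pointCoord_mem _ _) (x_mem _),
      tmul_mul_tmul _ _ _ _ (pointDiff_mem _ _) (x_mem _), x_comm, pointCoord_pointDiff_comm]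

theorem joinDiff_anticomm (P : Fin (N + 1) → Option (Fin (m + 1))) (i j : Fin (m + 1)) :
    (joinDiff P i * joinDiff P j : ProdForms K N m) = -(joinDiff P j * joinDiff P i) := by
  rw [joinDiff, joinDiff, Finset.sum_mul_sum, Finset.sum_mul_sum, Finset.sum_comm,
    ← Finset.sum_neg_distrib]
  refine Finset.sum_congr rfl fun b _ => ?_
  rw [← Finset.sum_neg_distrib]
  refine Finset.sum_congr rfl fun a _ => ?_
  rw [mul_add, add_mul, add_mul, mul_add, add_mul, add_mul,
    tmul_mul_tmul _ _ _ _ (pointCoord_mem _ _) (dx_mem _),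
    tmul_mul_tmul _ _ _ _ (pointCoord_mem _ _) (x_mem _),
    tmul_mul_tmul _ _ _ _ (pointDiff_mem _ _) (dx_mem _),
    tmul_mul_tmul _ _ _ _ (pointDiff_mem _ _) (x_mem _),
    tmul_mul_tmul _ _ _ _ (pointCoord_mem _ _) (dx_mem _),
    tmul_mul_tmul _ _ _ _ (pointCoord_mem _ _) (x_mem _),
    tmul_mul_tmul _ _ _ _ (pointDiff_mem _ _) (dx_mem _),
    tmul_mul_tmul _ _ _ _ (pointDiff_mem _ _) (x_mem _),
    dx_anticomm a b, x_dx_comm a b, ← x_dx_comm b a, x_comm a b,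
    pointCoord_comm (P a) (P b), ← pointCoord_pointDiff_comm (P b) (P a),
    pointCoord_pointDiff_comm (P a) (P b), pointDiff_anticomm (P a) (P b), neg_tmul', tmul_neg']
  simp
  abel

theorem sum_joinCoord (P : Fin (N + 1) → Option (Fin (m + 1))) :
    (∑ i, joinCoord P i : ProdForms K N m) = 1 := by
  simp only [joinCoord]
  rw [Finset.sum_comm]
  simp only [GradedTensorProduct.tmul, ← map_sum, ← TensorProduct.tmul_sum, sum_pointCoord,
    ← TensorProduct.sum_tmul, sum_x]
  rfl

theorem sum_joinDiff (P : Fin (N + 1) → Option (Fin (m + 1))) :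
    (∑ i, joinDiff P i : ProdForms K N m) = 0 := by
  simp only [joinDiff]
  rw [Finset.sum_comm]
  simp only [GradedTensorProduct.tmul, Finset.sum_add_distrib, ← map_sum, ← TensorProduct.tmul_sum,
    sum_pointCoord, sum_pointDiff, ← TensorProduct.sum_tmul, sum_dx, TensorProduct.zero_tmul,
    TensorProduct.tmul_zero, map_zero, add_zero]

variable (K) in
/-- The pull-back of forms `Ω_m → Ω_N ⊗ Ω_m` along the affine map `(y, v) ↦ ∑ₐ yₐ Pₐ(v)` from the
product of the `N`-simplex and the `m`-simplex to the `m`-simplex. -/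
def joinPullback (P : Fin (N + 1) → Option (Fin (m + 1))) : Omega K m →ₐ[K] ProdForms K N m :=
  lift (joinCoord P) (joinDiff P) (joinCoord_comm P) (joinCoord_joinDiff_comm P)
    (joinDiff_anticomm P) (sum_joinCoord P) (sum_joinDiff P)

/-- The map `φ ⊗ id : Ω_N ⊗ Ω_m → K ⊗ Ω_m = Ω_m`. -/
def contractLeft (φ : Omega K N →ₗ[K] K) : ProdForms K N m →ₗ[K] Omega K m :=
  (TensorProduct.lid K (Omega K m)).toLinearMap ∘ₗ TensorProduct.map φ LinearMap.id ∘ₗ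
    (GradedTensorProduct.of K (degreePart K N) (degreePart K m)).symm.toLinearMap


variable (K n) in
/-- The coordinates `x₀, …, xₙ` on the `n`-simplex written in the affine coordinates `x₁, …, xₙ`. -/
def localCoord : Fin (n + 1) → MvPolynomial (Fin n) K :=
  Fin.cons (1 - ∑ j, MvPolynomial.X j) MvPolynomial.X

variable (K n) in
/-- The differentials `dx₀, …, dxₙ` written in the basis `dx₁, …, dxₙ`. -/
def localDiff : Fin (n + 1) → Fin n → MvPolynomial (Fin n) K :=
  Fin.cons (-∑ j, Pi.single j 1) fun j => Pi.single j 1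

variable (K n) in
/-- A form on the `n`-simplex written in the affine coordinates `x₁, …, xₙ`. -/
def chart :
    Omega K n →ₐ[K] ExteriorAlgebra (MvPolynomial (Fin n) K) (Fin n → MvPolynomial (Fin n) K) :=
  lift (fun i => algebraMap _ _ (localCoord K n i))
    (fun i => ExteriorAlgebra.ι (MvPolynomial (Fin n) K) (localDiff K n i))
    (fun _ _ => Algebra.commutes _ _) (fun _ _ => Algebra.commutes _ _)
    (fun _ _ => eq_neg_of_add_eq_zero_left (ExteriorAlgebra.ι_add_mul_swap _ _))
    (by rw [← map_sum, Fin.sum_univ_succ]; simp [localCoord])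
    (by rw [← map_sum, Fin.sum_univ_succ]; simp [localDiff])

variable (K n) in
/-- The coefficient of `dx₁ ∧ … ∧ dxₙ`. -/
def topCoeff :
    ExteriorAlgebra (MvPolynomial (Fin n) K) (Fin n → MvPolynomial (Fin n) K)
      →ₗ[MvPolynomial (Fin n) K] MvPolynomial (Fin n) K :=
  ExteriorAlgebra.liftAlternating (Pi.single n Matrix.detRowAlternating)

variable (K n) in
/-- The integral of `P dx₁ ∧ … ∧ dxₙ` over the `n`-simplex, for a polynomial `P` in `x₁, …, xₙ`. -/
def polyIntegral : MvPolynomial (Fin n) K →ₗ[K] K :=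
  (MvPolynomial.basisMonomials (Fin n) K).constr K fun k =>
    (∏ j, ((k j).factorial : K)) / ((∑ j, k j + n).factorial : K)

variable (K n) in
/-- The integral of forms over the `n`-simplex. It is characterized by `integral_eq_zero` and
`integral_monomial`. -/
def integral : Omega K n →ₗ[K] K :=
  polyIntegral K n ∘ₗ (topCoeff K n).restrictScalars K ∘ₗ (chart K n).toLinearMap

theorem chart_mem {p : ℕ} {ω : Omega K n} (h : ω ∈ degreePart K n p) :
    chart K n ω ∈ ⋀[MvPolynomial (Fin n) K]^p (Fin n → MvPolynomial (Fin n) K) := by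
  induction h using Submodule.span_induction with
  | mem ω h =>
    obtain ⟨w, rfl, rfl⟩ := h
    induction w with
    | nil =>
      simp only [List.map_nil, List.prod_nil, map_one, List.countP_nil]
      exact SetLike.GradedOne.one_mem (A := fun i : ℕ ↦ ⋀[MvPolynomial (Fin n) K]^i (Fin n → MvPolynomial (Fin n) K))
    | cons a w ih =>
      rw [List.map_cons, List.prod_cons, map_mul, ← List.singleton_append, List.countP_append]
      refine SetLike.GradedMul.mul_mem (A := fun i : ℕ ↦ ⋀[MvPolynomial (Fin n) K]^i (Fin n → MvPolynomial (Fin n) K)) ?_ ih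
      rw [chart, lift_gen]
      cases a with
      | inl i => exact SetLike.algebraMap_mem_graded (fun i : ℕ ↦ ⋀[MvPolynomial (Fin n) K]^i (Fin n → MvPolynomial (Fin n) K)) _
      | inr i => simp
  | zero => rw [map_zero]; exact Submodule.zero_mem _
  | add a b _ _ ha hb => rw [map_add]; exact Submodule.add_mem _ ha hb
  | smul c a _ ha =>
    rw [map_smul, ← algebraMap_smul (MvPolynomial (Fin n) K) c (chart K n a)]
    exact Submodule.smul_mem _ _ ha

/-- The integral of a form of degree `p ≠ n` vanishes. -/
theorem integral_eq_zero {p : ℕ} (hp : p ≠ n) {ω : Omega K n} (h : ω ∈ degreePart K n p) :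
    integral K n ω = 0 := by
  have h' := chart_mem h
  rw [← exteriorPower.ιMulti_span_fixedDegree] at h'
  have : topCoeff K n (chart K n ω) = 0 := by
    generalize chart K n ω = c at h'
    induction h' using Submodule.span_induction with
    | mem ω h =>
      obtain ⟨v, rfl⟩ := h
      rw [topCoeff, ExteriorAlgebra.liftAlternating_apply_ιMulti, Pi.single_eq_of_ne hp]
      rfl
    | zero => exact map_zero _
    | add a b _ _ ha hb => rw [map_add, ha, hb, add_zero]
    | smul c a _ ha => rw [map_smul, ha, smul_zero]
  change polyIntegral K n (topCoeff K n (chart K n ω)) = 0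
  rw [this, map_zero]

theorem polyIntegral_monomial (k : Fin n →₀ ℕ) :
    polyIntegral K n (MvPolynomial.monomial k 1) =
      (∏ j, ((k j).factorial : K)) / ((∑ j, k j + n).factorial : K) := by
  have h := (MvPolynomial.basisMonomials (Fin n) K).constr_basis K (fun k =>
    (∏ j, ((k j).factorial : K)) / ((∑ j, k j + n).factorial : K)) k
  rwa [MvPolynomial.coe_basisMonomials] at h

theorem polyIntegral_pow [CharZero K] (a : ℕ) (k : Fin n →₀ ℕ) :
    polyIntegral K n ((1 - ∑ j, MvPolynomial.X j) ^ a * MvPolynomial.monomial k 1) =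
      (a.factorial * ∏ j, ((k j).factorial : K)) / ((a + ∑ j, k j + n).factorial : K) := by
  induction a generalizing k with
  | zero => simp [polyIntegral_monomial]
  | succ a ih =>
    have e : ((1 - ∑ j, MvPolynomial.X j) ^ (a + 1) * MvPolynomial.monomial k (1 : K)) =
        (1 - ∑ j, MvPolynomial.X j) ^ a * MvPolynomial.monomial k 1 -
          ∑ j, (1 - ∑ j, MvPolynomial.X j) ^ a * MvPolynomial.monomial (k + Finsupp.single j 1) 1 := by
      have : ∀ j, MvPolynomial.monomial (k + Finsupp.single j 1) (1 : K) =
          MvPolynomial.X j * MvPolynomial.monomial k 1 := by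
        intro j
        rw [MvPolynomial.X, MvPolynomial.monomial_mul, add_comm, one_mul]
      simp only [this]
      rw [← Finset.mul_sum, ← Finset.sum_mul]
      ring
    have hs : ∀ j : Fin n, ∑ i, (k + Finsupp.single j 1 : Fin n →₀ ℕ) i = ∑ i, k i + 1 := by
      intro j
      simp [Finset.sum_add_distrib, Finsupp.single_apply]
    have hp : ∀ j : Fin n, ∏ i, (((k + Finsupp.single j 1 : Fin n →₀ ℕ) i).factorial : K) =
        (k j + 1) * ∏ i, ((k i).factorial : K) := by
      intro j
      rw [← Finset.mul_prod_erase _ _ (Finset.mem_univ j),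
        ← Finset.mul_prod_erase _ (fun i => ((k i).factorial : K)) (Finset.mem_univ j)]
      have : ∏ i ∈ Finset.univ.erase j, (((k + Finsupp.single j 1 : Fin n →₀ ℕ) i).factorial : K) =
          ∏ i ∈ Finset.univ.erase j, ((k i).factorial : K) := by
        refine Finset.prod_congr rfl fun i hi => ?_
        rw [Finsupp.add_apply, Finsupp.single_eq_of_ne (Finset.ne_of_mem_erase hi), add_zero]
      rw [this]
      simp [Nat.factorial_succ]
      ring
    rw [e, map_sub, map_sum, ih]
    simp only [ih, hs, hp]
    rw [← Finset.sum_div, ← Finset.mul_sum, ← Finset.sum_mul, Finset.sum_add_distrib,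
      show a + (∑ i, k i + 1) + n = (a + ∑ i, k i + n) + 1 by ring,
      show a + 1 + ∑ i, k i + n = (a + ∑ i, k i + n) + 1 by ring]
    have h0 : ((a + ∑ i, k i + n).factorial : K) ≠ 0 := by exact_mod_cast Nat.factorial_ne_zero _
    have h1 : ((a + ∑ i, k i + n : ℕ) : K) + 1 ≠ 0 := Nat.cast_add_one_ne_zero _
    simp only [Nat.factorial_succ]
    push_cast at h1 ⊢
    simp only [Finset.sum_const, Finset.card_univ, Fintype.card_fin, nsmul_eq_mul, mul_one]
    field_simp
    ring

theorem det_localDiff (i : Fin (n + 1)) :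
    Matrix.det (fun j => localDiff K n (i.succAbove j)) = (-1) ^ (i : ℕ) := by
  have h := Matrix.submatrix_succAbove_det_eq_negOnePow_submatrix_succAbove_det
    (Matrix.of (localDiff K n)) (by
      change ∑ j, localDiff K n j = 0
      rw [Fin.sum_univ_succ]; simp [localDiff]) i 0
  have h0 : ((Matrix.of (localDiff K n)).submatrix (Fin.succAbove 0) id) = 1 := by
    ext a b
    simp [localDiff, Matrix.one_apply, Pi.single_apply, eq_comm]
  rw [h0, Matrix.det_one] at h
  refine Eq.trans ?_ (h.trans ?_)
  · rfl
  · simp [Int.negOnePow, Units.smul_def]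

/-- The integral of `x₀^k₀ ⋯ xₙ^kₙ dx₀ ∧ … ∧ dxᵢ₋₁ ∧ dxᵢ₊₁ ∧ … ∧ dxₙ`. -/
theorem integral_monomial [CharZero K] (k : Fin (n + 1) → ℕ) (i : Fin (n + 1)) :
    integral K n ((List.ofFn fun j => x j ^ k j).prod *
        (List.ofFn fun j : Fin n => dx (i.succAbove j)).prod) =
      (-1) ^ (i : ℕ) * (∏ j, ((k j).factorial : K)) / ((∑ j, k j + n).factorial : K) := by
  have hx : chart K n (List.ofFn fun j => x j ^ k j).prod =
      algebraMap (MvPolynomial (Fin n) K) _ ((1 - ∑ j, MvPolynomial.X j) ^ k 0 *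
        MvPolynomial.monomial (Finsupp.equivFunOnFinite.symm fun j : Fin n => k j.succ) 1) := by
    rw [map_list_prod, List.map_ofFn, MvPolynomial.monomial_eq, Finsupp.prod_fintype _ _ (by simp)]
    have : (⇑(chart K n) ∘ fun j => x j ^ k j) = (⇑(algebraMap (MvPolynomial (Fin n) K)
        (ExteriorAlgebra (MvPolynomial (Fin n) K) (Fin n → MvPolynomial (Fin n) K))) ∘
          fun j => localCoord K n j ^ k j) := by
      funext j
      simp only [Function.comp, map_pow, chart, lift_x]
    rw [this, ← List.map_ofFn, ← map_list_prod, List.prod_ofFn, Fin.prod_univ_succ]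
    simp [localCoord]
  have hd : chart K n (List.ofFn fun j : Fin n => dx (i.succAbove j)).prod =
      ExteriorAlgebra.ιMulti (MvPolynomial (Fin n) K) n fun j => localDiff K n (i.succAbove j) := by
    rw [map_list_prod, List.map_ofFn, ExteriorAlgebra.ιMulti_apply]
    congr 2
    funext j
    simp only [Function.comp, chart, lift_dx]
  change polyIntegral K n (topCoeff K n (chart K n _)) = _
  rw [map_mul, hx, hd, ← Algebra.smul_def, map_smul, topCoeff,
    ExteriorAlgebra.liftAlternating_apply_ιMulti, Pi.single_eq_same]
  change polyIntegral K n (_ • Matrix.det _) = _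
  rw [det_localDiff, smul_eq_mul, mul_comm, ← map_one MvPolynomial.C, ← map_neg, ← map_pow,
    ← MvPolynomial.smul_eq_C_mul, map_smul, map_one, polyIntegral_pow, Fin.prod_univ_succ, Fin.sum_univ_succ,
    smul_eq_mul, ← mul_div_assoc]
  simp


variable (K) in
/-- Forms on the `1`-simplex with coordinates `(s, t₀)` written as `q(s) + p(s) ds`, where
`t₀ = 1 - s`, `dt₀ = -ds` and `ds` is the square-zero element `ε`. -/
def intervalChart : Omega K 1 →ₐ[K] DualNumber (Polynomial K) :=
  lift ![TrivSqZeroExt.inl Polynomial.X, TrivSqZeroExt.inl (1 - Polynomial.X)]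
    ![TrivSqZeroExt.inr 1, TrivSqZeroExt.inr (-1)]
    (fun _ _ => mul_comm _ _) (fun _ _ => mul_comm _ _)
    (fun i j => by fin_cases i <;> fin_cases j <;> simp)
    (by simp [Fin.sum_univ_succ])
    (by simp [Fin.sum_univ_succ])

variable (K) in
/-- The polynomial `q` in the expression `q(s) + p(s) ds` of a form on the `1`-simplex. -/
def constCoeff : Omega K 1 →ₗ[K] Polynomial K :=
  (TrivSqZeroExt.fstHom K (Polynomial K) (Polynomial K)).toLinearMap ∘ₗ (intervalChart K).toLinearMap

variable (K) in
/-- The polynomial `p` in the expression `q(s) + p(s) ds` of a form on the `1`-simplex. -/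
def dsCoeff : Omega K 1 →ₗ[K] Polynomial K :=
  (TrivSqZeroExt.sndHom (Polynomial K) (Polynomial K)).restrictScalars K ∘ₗ (intervalChart K).toLinearMap

theorem dx_mul_self [CharZero K] (i : Fin (n + 1)) : (dx i * dx i : Omega K n) = 0 := by
  have h : (2 : K) • (dx i * dx i : Omega K n) = 0 := by
    rw [two_smul]
    exact eq_neg_iff_add_eq_zero.mp (dx_anticomm i i)
  exact (smul_eq_zero.mp h).resolve_left two_ne_zero

theorem commute_dx_aeval (p : Polynomial K) :
    Commute (dx 0 : Omega K 1) (Polynomial.aeval (x 0) p) := by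
  induction p using Polynomial.induction_on' with
  | add p q hp hq => rw [map_add]; exact hp.add_right hq
  | monomial k a =>
    rw [Polynomial.aeval_monomial]
    have h : Commute (dx 0 : Omega K 1) (x 0) := (x_dx_comm 0 0).symm
    exact (Algebra.commute_algebraMap_right a _).mul_right (h.pow_right k)

theorem eq_ds_mul_add [CharZero K] (ω : Omega K 1) :
    dx 0 * Polynomial.aeval (x 0) (dsCoeff K ω) + Polynomial.aeval (x 0) (constCoeff K ω) = ω := by
  have h0 : (dx 0 + dx 1 : Omega K 1) = 0 := by simpa [Fin.sum_univ_succ] using sum_dx (K := K) (n := 1)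
  have h1 : (x 0 + x 1 : Omega K 1) = 1 := by simpa [Fin.sum_univ_succ] using sum_x (K := K) (n := 1)
  have h : (DualNumber.lift ⟨(Polynomial.aeval (R := K) (x 0 : Omega K 1), dx 0), dx_mul_self 0,
      commute_dx_aeval⟩).comp (intervalChart K) = AlgHom.id K _ := by
    refine algHom_ext fun a => ?_
    rw [AlgHom.comp_apply, intervalChart, lift_gen, DualNumber.lift_apply_apply, AlgHom.id_apply]
    rcases a with i | i <;> fin_cases i
    · simp [x]
    · simp only [Sum.elim_inl]
      change _ = x 1
      simp [← h1]
    · simp [dx]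
    · simp only [Sum.elim_inr]
      change _ = dx 1
      simp [← eq_neg_of_add_eq_zero_right h0]
  have h2 := DFunLike.congr_fun h ω
  rw [AlgHom.comp_apply, DualNumber.lift_apply_apply, add_comm] at h2
  rw [commute_dx_aeval]
  exact h2

variable (K m) in
/-- The form `α ∈ Ω_m[s] = K[s] ⊗ Ω_m` in the decomposition `ω = ds ∧ α + β`. -/
def alphaPart : ProdForms K 1 m →ₗ[K] Polynomial K ⊗[K] Omega K m :=
  TensorProduct.map (dsCoeff K) LinearMap.id ∘ₗ
    (GradedTensorProduct.of K (degreePart K 1) (degreePart K m)).symm.toLinearMap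

variable (K m) in
/-- The form `β ∈ Ω_m[s] = K[s] ⊗ Ω_m` in the decomposition `ω = ds ∧ α + β`. -/
def betaPart : ProdForms K 1 m →ₗ[K] Polynomial K ⊗[K] Omega K m :=
  TensorProduct.map (constCoeff K) LinearMap.id ∘ₗ
    (GradedTensorProduct.of K (degreePart K 1) (degreePart K m)).symm.toLinearMap

variable (K m) in
/-- The inclusion of `Ω_m[s] = K[s] ⊗ Ω_m` into the forms on the product. -/
def ofPoly : Polynomial K ⊗[K] Omega K m →ₗ[K] ProdForms K 1 m :=
  (GradedTensorProduct.of K (degreePart K 1) (degreePart K m)).toLinearMap ∘ₗ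
    TensorProduct.map (Polynomial.aeval (x 0)).toLinearMap LinearMap.id

theorem aeval_mem (p : Polynomial K) : Polynomial.aeval (x 0) p ∈ degreePart K 1 0 := by
  induction p using Polynomial.induction_on' with
  | add p q hp hq => rw [map_add]; exact Submodule.add_mem _ hp hq
  | monomial k a =>
    rw [Polynomial.aeval_monomial, ← Algebra.smul_def]
    refine Submodule.smul_mem _ _ ?_
    simpa using SetLike.pow_mem_graded k (x_mem (K := K) (0 : Fin 2))

/-- The decomposition `ω = ds ∧ α + β`. -/
theorem eq_ds_alpha_add_beta [CharZero K] (ω : ProdForms K 1 m) :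
    dx 0 ᵍ⊗ₜ[K] 1 * ofPoly K m (alphaPart K m ω) + ofPoly K m (betaPart K m ω) = ω := by
  obtain ⟨ω, rfl⟩ := (GradedTensorProduct.of K (degreePart K 1) (degreePart K m)).surjective ω
  induction ω using TensorProduct.induction_on with
  | zero => simp
  | tmul a b =>
    change dx 0 ᵍ⊗ₜ[K] 1 * (Polynomial.aeval (x 0) (dsCoeff K a)) ᵍ⊗ₜ[K] b +
      (Polynomial.aeval (x 0) (constCoeff K a)) ᵍ⊗ₜ[K] b = a ᵍ⊗ₜ[K] b
    rw [tmul_mul_tmul _ _ _ _ SetLike.GradedOne.one_mem (aeval_mem _)]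
    simp only [mul_zero, pow_zero, one_smul, one_mul]
    rw [GradedTensorProduct.tmul, GradedTensorProduct.tmul, ← map_add, ← TensorProduct.add_tmul,
      eq_ds_mul_add]
  | add a b ha hb =>
    simp only [map_add, mul_add]
    conv_rhs => rw [← ha, ← hb]
    abel

variable (K) in
/-- The integral `∫₀¹ p(s) ds` of a polynomial. -/
def unitIntegral : Polynomial K →ₗ[K] K :=
  (Polynomial.basisMonomials K).constr K fun k => 1 / ((k : K) + 1)

variable (K) in
/-- Dupont's operator `h_j`: pull back along `((s, t₀), v) ↦ s e_j + t₀ v`, write the result as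
`ds ∧ α + β`, and integrate `α` over `0 ≤ s ≤ 1`. -/
def dupontVertex (j : Fin (m + 1)) : Omega K m →ₗ[K] Omega K m :=
  (TensorProduct.lid K (Omega K m)).toLinearMap ∘ₗ
    TensorProduct.map (unitIntegral K) LinearMap.id ∘ₗ alphaPart K m ∘ₗ
      (joinPullback K ![some j, none]).toLinearMap

variable (K) in
/-- The operator `h_f = h_{f(n)} ∘ ⋯ ∘ h_{f(0)}`. -/
def dupontFace (f : Fin (n + 1) ↪o Fin (m + 1)) : Omega K m →ₗ[K] Omega K m :=
  (List.ofFn fun i => (dupontVertex K (f i) : Module.End K (Omega K m))).reverse.prod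

variable (K) in
/-- Manetti's operator `k_f`: pull back along `((s, t₀, …, tₙ), v) ↦ s v + ∑ tᵢ e_{f(i)}`, then
integrate over the simplex with coordinates `(s, t₀, …, tₙ)`. -/
def manettiFace (f : Fin (n + 1) ↪o Fin (m + 1)) : Omega K m →ₗ[K] Omega K m :=
  contractLeft (integral K (n + 1)) ∘ₗ (joinPullback K (Fin.cons none fun i => some (f i))).toLinearMap

variable (K) in
/-- The Whitney elementary form
`ω_f = n! ∑ᵢ (-1)^i x_{f(i)} dx_{f(0)} ∧ … ∧ dx_{f(i-1)} ∧ dx_{f(i+1)} ∧ … ∧ dx_{f(n)}`. -/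
def whitney (f : Fin (n + 1) ↪o Fin (m + 1)) : Omega K m :=
  (n.factorial : K) • ∑ i : Fin (n + 1), (-1) ^ (i : ℕ) *
    (x (f i) * (List.ofFn fun j : Fin n => dx (f (i.succAbove j))).prod)

variable (K m) in
/-- Dupont's operator `h_m(η) = ∑ₙ ∑_f ω_f ∧ h_f(η)`, with `0 ≤ n ≤ m` and `f` ranging over the
strictly increasing maps from `{0, …, n}` to `{0, …, m}`. -/
def dupontOp : Omega K m →ₗ[K] Omega K m :=
  ∑ n ∈ Finset.range (m + 1), ∑ f : Fin (n + 1) ↪o Fin (m + 1),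
    LinearMap.mulLeft K (whitney K f) ∘ₗ dupontFace K f

variable (K m) in
/-- Manetti's operator `k_m(η) = ∑ₙ ∑_f ω_f ∧ k_f(η)`, with `0 ≤ n ≤ m` and `f` ranging over the
strictly increasing maps from `{0, …, n}` to `{0, …, m}`. -/
def manettiOp : Omega K m →ₗ[K] Omega K m :=
  ∑ n ∈ Finset.range (m + 1), ∑ f : Fin (n + 1) ↪o Fin (m + 1),
    LinearMap.mulLeft K (whitney K f) ∘ₗ manettiFace K f

end SimplexForms

end

noncomputable section

open scoped TensorProduct DirectSum

namespace SimplexForms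

variable {K : Type*} [Field K] {n N m : ℕ}

/-! The two sums agree term by term: for each face, Manetti's operator `k_f` equals the composition
`h_f` of Dupont's vertex operators. Composing cones gives an iterated join. Contracting first
towards a vertex e_j and then pulling back along v' = ∑ yₐ Pₐ(v) amounts to using the map s e_j + t
∑ yₐ Pₐ(v), in which the numbers s, t yₐ are barycentric coordinates on a simplex of one dimension
more. So both operators are instances of one construction, `joinContract P φ`: pull back along y ↦ ∑
yₐ Pₐ(v), then apply a linear functional φ to the forms in y.

Two facts carry the proof. `joinContract_joinContract_cone` says that composing with a cone inserts
the vertex into P and replaces the functionals φ, ψ by `coneFunctional v φ ψ`, which evaluates forms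
on the larger simplex through its cone coordinates. `coneFunctional_integral` says that integrating
over 0 ≤ s ≤ 1 and then over the opposite face is integration over the whole simplex; on monomials
this is the beta integral. Induction on the number of vertices then yields
`joinContract_integral_eq_prod`.

Signs are tracked without splitting forms into homogeneous parts: `scale (-1)` multiplies p-forms by
(-1)^p, so precomposing a functional with it supplies the Koszul sign. Identities about
`joinContract` are then proved by peeling off one generator at a time. -/

/-! ### Induction and extensionality for forms -/

/-- Induction over forms by left multiplication with the generators. -/
theorem omega_induction {p : Omega K n → Prop} (one : p 1)
    (x_mul : ∀ i η, p η → p (x i * η)) (dx_mul : ∀ i η, p η → p (dx i * η))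
    (add : ∀ a b, p a → p b → p (a + b)) (smul : ∀ (c : K) a, p a → p (c • a))
    (η : Omega K n) : p η := by
  obtain ⟨a, rfl⟩ : ∃ a, mk K n a = η := RingQuot.mkAlgHom_surjective K _ η
  -- The property is strengthened to stability under left multiplication by `a`, which composes
  -- along products in the free algebra.
  suffices h : ∀ η, p η → p (mk K n a * η) by simpa using h 1 one
  induction a using FreeAlgebra.induction with
  | grade0 r =>
    intro η h
    rw [AlgHom.commutes, ← Algebra.smul_def]
    exact smul r η h
  | grade1 g =>
    intro η h
    cases g with
    | inl i => exact x_mul i η h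
    | inr i => exact dx_mul i η h
  | mul a b ha hb =>
    intro η h
    rw [map_mul, mul_assoc]
    exact ha _ (hb _ h)
  | add a b ha hb =>
    intro η h
    rw [map_add, add_mul]
    exact add _ _ (ha _ h) (hb _ h)

/-- Two linear maps on forms agree if they agree on the products of generators. -/
theorem linearMap_ext_word {M : Type*} [AddCommMonoid M] [Module K M] {φ ψ : Omega K n →ₗ[K] M}
    (h : ∀ w : List (Fin (n + 1) ⊕ Fin (n + 1)), φ (w.map gen).prod = ψ (w.map gen).prod) :
    φ = ψ := by
  have hs : ∀ η : Omega K n, η ∈ Submodule.span K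
      (Set.range fun w : List (Fin (n + 1) ⊕ Fin (n + 1)) => (w.map (gen (K := K))).prod) := by
    have hg : ∀ (g : Fin (n + 1) ⊕ Fin (n + 1)) (η : Omega K n),
        η ∈ Submodule.span K (Set.range fun w : List (Fin (n + 1) ⊕ Fin (n + 1)) =>
          (w.map (gen (K := K))).prod) →
        gen g * η ∈ Submodule.span K (Set.range fun w : List (Fin (n + 1) ⊕ Fin (n + 1)) =>
          (w.map (gen (K := K))).prod) := by
      intro g η hη
      induction hη using Submodule.span_induction with
      | mem η hη =>
        obtain ⟨w, rfl⟩ := hη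
        exact Submodule.subset_span ⟨g :: w, by simp⟩
      | zero => simp
      | add a b _ _ ha hb => rw [mul_add]; exact Submodule.add_mem _ ha hb
      | smul c a _ ha => rw [mul_smul_comm]; exact Submodule.smul_mem _ _ ha
    intro η
    induction η using omega_induction with
    | one => exact Submodule.subset_span ⟨[], by simp⟩
    | x_mul i η h => exact hg _ _ h
    | dx_mul i η h => exact hg _ _ h
    | add a b ha hb => exact Submodule.add_mem _ ha hb
    | smul c a ha => exact Submodule.smul_mem _ _ ha
  ext η
  refine LinearMap.eqOn_span ?_ (hs η)
  rintro _ ⟨w, rfl⟩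
  exact h w

/-! ### Degree scaling and operations on functionals -/

/-- The algebra endomorphism multiplying forms of degree `p` by `c ^ p`. -/
def scale (c : K) : Omega K n →ₐ[K] Omega K n :=
  lift x (fun i => c • dx i) x_comm
    (fun i j => by rw [mul_smul_comm, smul_mul_assoc, x_dx_comm])
    (fun i j => by
      rw [smul_mul_smul_comm, smul_mul_smul_comm, dx_anticomm, smul_neg])
    sum_x (by rw [← Finset.smul_sum, sum_dx, smul_zero])

theorem scale_x (c : K) (i : Fin (n + 1)) : scale c (x i : Omega K n) = x i :=
  lift_x _ _ _ _ _ _ _ i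

theorem scale_dx (c : K) (i : Fin (n + 1)) : scale c (dx i : Omega K n) = c • dx i :=
  lift_dx _ _ _ _ _ _ _ i

theorem scale_of_mem (c : K) {p : ℕ} {ω : Omega K n} (h : ω ∈ degreePart K n p) :
    scale c ω = c ^ p • ω := by
  induction h using Submodule.span_induction with
  | mem ω h =>
    obtain ⟨w, rfl, rfl⟩ := h
    induction w with
    | nil => simp
    | cons g w ih =>
      rw [List.map_cons, List.prod_cons, map_mul, ih]
      cases g with
      | inl i =>
        have : scale c (gen (.inl i) : Omega K n) = gen (.inl i) := scale_x c i
        rw [this]; simp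
      | inr i =>
        have : scale c (gen (.inr i) : Omega K n) = c • gen (.inr i) := scale_dx c i
        rw [this, smul_mul_smul_comm]
        rw [List.countP_cons_of_pos (by rfl), pow_succ']
  | zero => simp
  | add a b _ _ ha hb => rw [map_add, ha, hb, smul_add]
  | smul r a _ ha => rw [map_smul, ha, smul_comm]

theorem scale_comm (c d : K) (ω : Omega K n) : scale c (scale d ω) = scale d (scale c ω) := by
  have : (scale c).comp (scale d) = (scale d).comp (scale (n := n) c) := by
    refine algHom_ext fun g => ?_
    cases g with
    | inl i =>
      change scale c (scale d (x i)) = scale d (scale c (x i))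
      simp only [scale_x]
    | inr i =>
      change scale c (scale d (dx i)) = scale d (scale c (dx i))
      simp only [scale_dx, map_smul, smul_comm c d]
  exact DFunLike.congr_fun this ω

/-- The functional `ω ↦ φ (a ∧ ω)`. -/
def precMul (φ : Omega K n →ₗ[K] K) (a : Omega K n) : Omega K n →ₗ[K] K :=
  φ ∘ₗ LinearMap.mulLeft K a

/-- The functional `ω ↦ φ (scale c ω)`. -/
def precScale (φ : Omega K n →ₗ[K] K) (c : K) : Omega K n →ₗ[K] K :=
  φ ∘ₗ (scale c).toLinearMap

@[simp] theorem precMul_apply (φ : Omega K n →ₗ[K] K) (a ω : Omega K n) :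
    precMul φ a ω = φ (a * ω) := rfl

@[simp] theorem precScale_apply (φ : Omega K n →ₗ[K] K) (c : K) (ω : Omega K n) :
    precScale φ c ω = φ (scale c ω) := rfl

theorem precMul_precMul (φ : Omega K n →ₗ[K] K) (a b : Omega K n) :
    precMul (precMul φ a) b = precMul φ (a * b) := by
  ext ω
  simp [mul_assoc]

theorem precScale_precMul_x (φ : Omega K n →ₗ[K] K) (c : K) (i : Fin (n + 1)) :
    precMul (precScale φ c) (x i) = precScale (precMul φ (x i)) c := by
  ext ω
  simp [scale_x]

theorem precScale_precMul_dx (φ : Omega K n →ₗ[K] K) (c : K) (i : Fin (n + 1)) :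
    precMul (precScale φ c) (dx i) = c • precScale (precMul φ (dx i)) c := by
  ext ω
  simp [scale_dx]

theorem precScale_comm (φ : Omega K n →ₗ[K] K) (c d : K) :
    precScale (precScale φ c) d = precScale (precScale φ d) c := by
  ext ω
  simp [scale_comm c d]

/-! ### Contraction of forms pulled back along a join -/

theorem contractLeft_tmul (φ : Omega K N →ₗ[K] K) (a : Omega K N) (b : Omega K m) :
    contractLeft φ (a ᵍ⊗ₜ[K] b : ProdForms K N m) = φ a • b := rfl

/-- Linear maps on forms on a product agree if they agree on decomposable forms whose
first factor is homogeneous. -/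
theorem prodForms_ext {M : Type*} [AddCommMonoid M] [Module K M] {f g : ProdForms K N m →ₗ[K] M}
    (h : ∀ (p : ℕ) (a : Omega K N) (b : Omega K m), a ∈ degreePart K N p →
      f (a ᵍ⊗ₜ[K] b) = g (a ᵍ⊗ₜ[K] b)) : f = g := by
  have : f ∘ₗ (GradedTensorProduct.of K (degreePart K N) (degreePart K m)).toLinearMap =
      g ∘ₗ (GradedTensorProduct.of K (degreePart K N) (degreePart K m)).toLinearMap := by
    refine TensorProduct.ext (linearMap_ext_word fun w => ?_)
    ext b
    exact h _ _ b (word_mem w)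
  refine LinearMap.ext fun ω => ?_
  obtain ⟨ω, rfl⟩ := (GradedTensorProduct.of K (degreePart K N) (degreePart K m)).surjective ω
  exact DFunLike.congr_fun this ω

/-- Moving `c` of degree q past a first factor of degree p costs (-1)^(qp), and this is what `scale
((-1) ^ q)` does to that factor. Hence the formula holds for every `ω`, homogeneous or not. -/
theorem contractLeft_tmul_mul (φ : Omega K N →ₗ[K] K) (a : Omega K N) {q : ℕ} {c : Omega K m}
    (hc : c ∈ degreePart K m q) (ω : ProdForms K N m) :
    contractLeft φ (a ᵍ⊗ₜ[K] c * ω) =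
      c * contractLeft (precScale (precMul φ a) ((-1) ^ q)) ω := by
  have : contractLeft φ ∘ₗ LinearMap.mulLeft K (a ᵍ⊗ₜ[K] c : ProdForms K N m) =
      LinearMap.mulLeft K c ∘ₗ contractLeft (precScale (precMul φ a) ((-1) ^ q)) := by
    refine prodForms_ext fun p a' b ha' => ?_
    simp only [LinearMap.comp_apply, LinearMap.mulLeft_apply, contractLeft_tmul,
      precScale_apply, precMul_apply]
    rw [tmul_mul_tmul _ _ _ _ hc ha', scale_of_mem _ ha', ← pow_mul]
    rcases Nat.even_or_odd (q * p) with h | h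
    · simp [h.neg_one_pow, contractLeft_tmul]
    · simp [h.neg_one_pow, contractLeft_tmul]
  exact DFunLike.congr_fun this ω

theorem precScale_one (φ : Omega K n →ₗ[K] K) : precScale φ 1 = φ := by
  have : scale (1 : K) = AlgHom.id K (Omega K n) := by
    refine algHom_ext fun g => ?_
    cases g with
    | inl i => exact scale_x 1 i
    | inr i => exact (scale_dx 1 i).trans (one_smul _ _)
  rw [precScale, this]
  rfl

/-- Pull back along `(y, v) ↦ ∑ₐ yₐ Pₐ(v)` and apply a functional to the forms in `y`. -/
def joinContract (P : Fin (N + 1) → Option (Fin (m + 1))) (φ : Omega K N →ₗ[K] K) :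
    Omega K m →ₗ[K] Omega K m :=
  contractLeft φ ∘ₗ (joinPullback K P).toLinearMap

theorem joinContract_one (P : Fin (N + 1) → Option (Fin (m + 1))) (φ : Omega K N →ₗ[K] K) :
    joinContract P φ 1 = φ 1 • 1 := by
  change contractLeft φ (joinPullback K P 1) = _
  rw [map_one]
  exact contractLeft_tmul φ 1 1

/-- Together with the value at 1 and the rule for `dx i`, this determines `joinContract P φ`
recursively. The functional absorbs the factor in y, so the recursion runs over all functionals at
once. -/
theorem joinContract_x_mul (P : Fin (N + 1) → Option (Fin (m + 1))) (φ : Omega K N →ₗ[K] K)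
    (i : Fin (m + 1)) (η : Omega K m) :
    joinContract P φ (x i * η) =
      ∑ a, pointCoord (P a) i * joinContract P (precMul φ (x a)) η := by
  change contractLeft φ (joinPullback K P (x i * η)) = _
  rw [map_mul, joinPullback, lift_x, joinCoord, Finset.sum_mul, map_sum]
  refine Finset.sum_congr rfl fun a _ => ?_
  rw [contractLeft_tmul_mul φ _ (pointCoord_mem _ _), pow_zero, precScale_one]
  rfl

/-- The Leibniz rule for d(∑ yₐ Pₐ(v)): the differential falls on yₐ or on Pₐ(v). In the second case
a 1-form in v is pulled out to the left past the remaining y-forms, whence the -1. -/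
theorem joinContract_dx_mul (P : Fin (N + 1) → Option (Fin (m + 1))) (φ : Omega K N →ₗ[K] K)
    (i : Fin (m + 1)) (η : Omega K m) :
    joinContract P φ (dx i * η) =
      ∑ a, (pointCoord (P a) i * joinContract P (precMul φ (dx a)) η +
        pointDiff (P a) i * joinContract P (precScale (precMul φ (x a)) (-1)) η) := by
  change contractLeft φ (joinPullback K P (dx i * η)) = _
  rw [map_mul, joinPullback, lift_dx, joinDiff, Finset.sum_mul, map_sum]
  refine Finset.sum_congr rfl fun a _ => ?_
  rw [add_mul, map_add, contractLeft_tmul_mul φ _ (pointCoord_mem _ _), pow_zero, precScale_one,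
    contractLeft_tmul_mul φ _ (pointDiff_mem _ _), pow_one]
  rfl

theorem joinContract_smul (P : Fin (N + 1) → Option (Fin (m + 1))) (c : K)
    (φ : Omega K N →ₗ[K] K) : joinContract P (c • φ) = c • joinContract P φ := by
  have : contractLeft (m := m) (c • φ) = c • contractLeft φ :=
    prodForms_ext fun p a b _ => by simp [contractLeft_tmul, mul_smul]
  rw [joinContract, this]
  rfl

theorem joinContract_add (P : Fin (N + 1) → Option (Fin (m + 1)))
    (φ ψ : Omega K N →ₗ[K] K) :
    joinContract P (φ + ψ) = joinContract P φ + joinContract P ψ := by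
  have : contractLeft (m := m) (φ + ψ) = contractLeft φ + contractLeft ψ :=
    prodForms_ext fun p a b _ => by simp [contractLeft_tmul, add_smul]
  rw [joinContract, this]
  rfl

theorem scale_pointCoord (c : K) (P : Option (Fin (m + 1))) (i : Fin (m + 1)) :
    scale c (pointCoord P i : Omega K m) = pointCoord P i := by
  rw [scale_of_mem c (pointCoord_mem P i), pow_zero, one_smul]

theorem scale_pointDiff (c : K) (P : Option (Fin (m + 1))) (i : Fin (m + 1)) :
    scale c (pointDiff P i : Omega K m) = c • pointDiff P i := by
  rw [scale_of_mem c (pointDiff_mem P i), pow_one]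

/-- Pull-back preserves total degree, which is the degree in y plus the degree in v. -/
theorem joinContract_scale (P : Fin (N + 1) → Option (Fin (m + 1))) (c : K)
    (φ : Omega K N →ₗ[K] K) (η : Omega K m) :
    joinContract P φ (scale c η) = scale c (joinContract P (precScale φ c) η) := by
  induction η using omega_induction generalizing φ with
  | one => simp [joinContract_one]
  | x_mul i η h =>
    rw [map_mul, scale_x, joinContract_x_mul, joinContract_x_mul, map_sum]
    refine Finset.sum_congr rfl fun a _ => ?_
    rw [h, map_mul, scale_pointCoord, precScale_precMul_x]
  | dx_mul i η h =>
    rw [map_mul, scale_dx, smul_mul_assoc, map_smul, joinContract_dx_mul, joinContract_dx_mul,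
      map_sum, Finset.smul_sum]
    refine Finset.sum_congr rfl fun a _ => ?_
    rw [h, h, map_add, map_mul, map_mul, scale_pointCoord, scale_pointDiff, precScale_precMul_x,
      precScale_precMul_dx, precScale_comm, joinContract_smul]
    simp
  | add a b ha hb => simp only [map_add, ha, hb]
  | smul r a ha => simp only [map_smul, ha]

/-! ### Cones over a face and composition of contractions -/

variable (K) in
/-- Restriction of forms to the face opposite to the vertex `v`. -/
def restrictFace (v : Fin (N + 2)) : Omega K (N + 1) →ₐ[K] Omega K N :=
  lift (Fin.insertNth (α := fun _ => Omega K N) v 0 x)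
    (Fin.insertNth (α := fun _ => Omega K N) v 0 dx)
    (by simp [Fin.forall_iff_succAbove v, x_comm])
    (by simp [Fin.forall_iff_succAbove v, x_dx_comm])
    (by
      simp only [Fin.forall_iff_succAbove v, Fin.insertNth_apply_same,
        Fin.insertNth_apply_succAbove, mul_zero, zero_mul, neg_zero, implies_true, true_and]
      exact fun _ _ => dx_anticomm _ _)
    (by simp [Fin.sum_univ_succAbove _ v, sum_x])
    (by simp [Fin.sum_univ_succAbove _ v, sum_dx])

@[simp] theorem restrictFace_x_same (v : Fin (N + 2)) : restrictFace K v (x v) = 0 := by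
  rw [restrictFace, lift_x, Fin.insertNth_apply_same]

@[simp] theorem restrictFace_dx_same (v : Fin (N + 2)) : restrictFace K v (dx v) = 0 := by
  rw [restrictFace, lift_dx, Fin.insertNth_apply_same]

@[simp] theorem restrictFace_x_succAbove (v : Fin (N + 2)) (b : Fin (N + 1)) :
    restrictFace K v (x (v.succAbove b)) = x b := by
  rw [restrictFace, lift_x, Fin.insertNth_apply_succAbove]

@[simp] theorem restrictFace_dx_succAbove (v : Fin (N + 2)) (b : Fin (N + 1)) :
    restrictFace K v (dx (v.succAbove b)) = dx b := by
  rw [restrictFace, lift_dx, Fin.insertNth_apply_succAbove]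

theorem restrictFace_scale (v : Fin (N + 2)) (c : K) (ω : Omega K (N + 1)) :
    restrictFace K v (scale c ω) = scale c (restrictFace K v ω) := by
  have : (restrictFace K v).comp (scale c) = (scale c).comp (restrictFace K v) := by
    refine algHom_ext fun g => ?_
    cases g with
    | inl i =>
      change restrictFace K v (scale c (x i)) = scale c (restrictFace K v (x i))
      cases i using Fin.succAboveCases v <;> simp [scale_x]
    | inr i =>
      change restrictFace K v (scale c (dx i)) = scale c (restrictFace K v (dx i))
      cases i using Fin.succAboveCases v <;> simp [scale_dx]
  exact DFunLike.congr_fun this ω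

/-- The contraction along `((s, t), v) ↦ s e_j + t v` of a product with `xᵢ`. -/
theorem joinContract_cone_x_mul (j i : Fin (m + 1)) (φ : Omega K 1 →ₗ[K] K) (η : Omega K m) :
    joinContract ![some j, none] φ (x i * η) =
      (if i = j then 1 else 0) * joinContract ![some j, none] (precMul φ (x 0)) η +
        x i * joinContract ![some j, none] (precMul φ (x 1)) η := by
  rw [joinContract_x_mul, Fin.sum_univ_two]
  rfl

theorem joinContract_cone_dx_mul (j i : Fin (m + 1)) (φ : Omega K 1 →ₗ[K] K) (η : Omega K m) :
    joinContract ![some j, none] φ (dx i * η) =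
      (if i = j then 1 else 0) * joinContract ![some j, none] (precMul φ (dx 0)) η +
        (x i * joinContract ![some j, none] (precMul φ (dx 1)) η +
          dx i * joinContract ![some j, none] (precScale (precMul φ (x 1)) (-1)) η) := by
  rw [joinContract_dx_mul, Fin.sum_univ_two]
  simp [pointCoord, pointDiff]

/-- The functional on forms on the simplex obtained, by means of the cone structure
`((s, t), y) ↦ s e_v + t y` of the simplex over the face opposite to `v`, from functionals
on the forms in `(s, t)` and on the forms on the face. -/
def coneFunctional (v : Fin (N + 2)) (φ : Omega K 1 →ₗ[K] K) (ψ : Omega K N →ₗ[K] K) :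
    Omega K (N + 1) →ₗ[K] K :=
  ψ ∘ₗ (restrictFace K v).toLinearMap ∘ₗ joinContract ![some v, none] φ

theorem coneFunctional_apply (v : Fin (N + 2)) (φ : Omega K 1 →ₗ[K] K) (ψ : Omega K N →ₗ[K] K)
    (ω : Omega K (N + 1)) : coneFunctional v φ ψ ω =
      ψ (restrictFace K v (joinContract ![some v, none] φ ω)) := rfl

theorem coneFunctional_one (v : Fin (N + 2)) (φ : Omega K 1 →ₗ[K] K) (ψ : Omega K N →ₗ[K] K) :
    coneFunctional v φ ψ 1 = φ 1 * ψ 1 := by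
  simp [coneFunctional_apply, joinContract_one]

/-- On s e_v + t y, with y in the face opposite to e_v, the v-th coordinate is s and the others are
t y_b. This rule and the three that follow are the resulting product rules. -/
theorem precMul_coneFunctional_x_same (v : Fin (N + 2)) (φ : Omega K 1 →ₗ[K] K)
    (ψ : Omega K N →ₗ[K] K) :
    precMul (coneFunctional v φ ψ) (x v) = coneFunctional v (precMul φ (x 0)) ψ := by
  ext ω
  simp [coneFunctional_apply, joinContract_cone_x_mul]

theorem precMul_coneFunctional_x (v : Fin (N + 2)) (b : Fin (N + 1)) (φ : Omega K 1 →ₗ[K] K)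
    (ψ : Omega K N →ₗ[K] K) :
    precMul (coneFunctional v φ ψ) (x (v.succAbove b)) =
      coneFunctional v (precMul φ (x 1)) (precMul ψ (x b)) := by
  ext ω
  simp [coneFunctional_apply, joinContract_cone_x_mul]

theorem precMul_coneFunctional_dx_same (v : Fin (N + 2)) (φ : Omega K 1 →ₗ[K] K)
    (ψ : Omega K N →ₗ[K] K) :
    precMul (coneFunctional v φ ψ) (dx v) = coneFunctional v (precMul φ (dx 0)) ψ := by
  ext ω
  simp [coneFunctional_apply, joinContract_cone_dx_mul]

/-- From d(t y_b) = dt y_b + t dy_b; the -1 records that dy_b crosses the remaining forms in (s, t).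
-/
theorem precMul_coneFunctional_dx (v : Fin (N + 2)) (b : Fin (N + 1)) (φ : Omega K 1 →ₗ[K] K)
    (ψ : Omega K N →ₗ[K] K) :
    precMul (coneFunctional v φ ψ) (dx (v.succAbove b)) =
      coneFunctional v (precMul φ (dx 1)) (precMul ψ (x b)) +
        coneFunctional v (precScale (precMul φ (x 1)) (-1)) (precMul ψ (dx b)) := by
  ext ω
  simp [coneFunctional_apply, joinContract_cone_dx_mul]

theorem precScale_coneFunctional (v : Fin (N + 2)) (c : K) (φ : Omega K 1 →ₗ[K] K)
    (ψ : Omega K N →ₗ[K] K) :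
    precScale (coneFunctional v φ ψ) c = coneFunctional v (precScale φ c) (precScale ψ c) := by
  ext ω
  simp [coneFunctional_apply, joinContract_scale, restrictFace_scale]

/-- The contraction along a cone followed by another contraction is the contraction along
the iterated join. -/
theorem joinContract_joinContract_cone (v : Fin (N + 2)) (j : Fin (m + 1))
    (P : Fin (N + 1) → Option (Fin (m + 1)))
    (φ : Omega K 1 →ₗ[K] K) (ψ : Omega K N →ₗ[K] K) (η : Omega K m) :
    joinContract P ψ (joinContract ![some j, none] φ η) =
      joinContract (Fin.insertNth (α := fun _ => Option (Fin (m + 1))) v (some j) P)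
        (coneFunctional v φ ψ) η := by
  -- Each generator that is peeled off gets absorbed into the functionals, so the induction
  -- hypothesis is needed for all of them.
  induction η using omega_induction generalizing φ ψ with
  | one => simp [joinContract_one, coneFunctional_one, smul_smul]
  | x_mul i η h =>
    rw [joinContract_cone_x_mul, map_add, joinContract_x_mul, joinContract_x_mul,
      Fin.sum_univ_succAbove _ v]
    simp only [Fin.insertNth_apply_same, Fin.insertNth_apply_succAbove,
      precMul_coneFunctional_x_same, precMul_coneFunctional_x, ← h]
    congr 1
    -- The terms indexed by the other vertices match; for e_j the coefficient is the constant 0 or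
    -- 1, which passes through the contraction.
    simp only [pointCoord, Option.elim_some]
    split_ifs <;> simp
  | dx_mul i η h =>
    have hz : (pointDiff (some j) i : Omega K m) = 0 := rfl
    rw [joinContract_cone_dx_mul, map_add, map_add, joinContract_x_mul, joinContract_dx_mul,
      joinContract_dx_mul, Fin.sum_univ_succAbove _ v, ← Finset.sum_add_distrib]
    simp only [Fin.insertNth_apply_same, Fin.insertNth_apply_succAbove,
      precMul_coneFunctional_x_same, precMul_coneFunctional_x, precMul_coneFunctional_dx_same,
      precMul_coneFunctional_dx, precScale_coneFunctional, joinContract_add,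
      LinearMap.add_apply, mul_add, ← h, hz, zero_mul, add_zero,
      add_assoc]
    congr 1
    simp only [pointCoord, Option.elim_some]
    split_ifs <;> simp
  | add a b ha hb => simp only [map_add, ha, hb]
  | smul r a ha => simp only [map_smul, ha]

/-- Contraction with a functional on forms on a point. -/
theorem joinContract_none (φ : Omega K 0 →ₗ[K] K) (P : Fin 1 → Option (Fin (m + 1)))
    (hP : P 0 = none) (η : Omega K m) : joinContract P φ η = φ 1 • η := by
  have hx : (x 0 : Omega K 0) = 1 := by simpa using sum_x (K := K) (n := 0)
  have hdx : (dx 0 : Omega K 0) = 0 := by simpa using sum_dx (K := K) (n := 0)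
  induction η using omega_induction generalizing φ with
  | one => simp [joinContract_one]
  | x_mul i η h => simp [joinContract_x_mul, h, hP, hx, pointCoord]
  | dx_mul i η h => simp [joinContract_dx_mul, h, hP, hx, hdx, pointDiff]
  | add a b ha hb => simp only [map_add, ha, hb, smul_add]
  | smul r a ha => simp only [map_smul, ha, smul_comm r]

/-! ### Functionals on top-degree forms -/

theorem mul_prod_ofFn_pow {R : Type*} [Monoid R] {l : ℕ} (X : Fin l → R)
    (hX : ∀ i j, X i * X j = X j * X i) (k : Fin l → ℕ) (i : Fin l) :
    X i * (List.ofFn fun j => X j ^ k j).prod =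
      (List.ofFn fun j => X j ^ Function.update k i (k i + 1) j).prod := by
  induction l with
  | zero => exact i.elim0
  | succ l ih =>
    rw [List.ofFn_succ, List.ofFn_succ, List.prod_cons, List.prod_cons]
    cases i using Fin.cases with
    | zero =>
      rw [← mul_assoc, ← pow_succ', Function.update_self]
      congr 3
    | succ i =>
      have hc : X i.succ * X 0 ^ k 0 = X 0 ^ k 0 * X i.succ :=
        (show Commute (X i.succ) (X 0) from hX _ _).pow_right _
      rw [← mul_assoc, hc, mul_assoc, ih (fun j => X j.succ) (fun _ _ => hX _ _)
        (fun j => k j.succ) i, Function.update_of_ne (Fin.succ_ne_zero i).symm]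
      congr 3
      funext j
      congr 1
      by_cases h : j = i
      · subst h; simp
      · rw [Function.update_of_ne h, Function.update_of_ne (by simpa using h)]

variable (n) in
/-- The monomial `x₀^k₀ ⋯ xₙ^kₙ`. -/
def xMonomial (k : Fin (n + 1) → ℕ) : Omega K n := (List.ofFn fun j => x j ^ k j).prod

theorem x_mul_xMonomial (k : Fin (n + 1) → ℕ) (i : Fin (n + 1)) :
    (x i * xMonomial n k : Omega K n) = xMonomial n (Function.update k i (k i + 1)) :=
  mul_prod_ofFn_pow x x_comm k i

theorem commute_dx_xMonomial (k : Fin (n + 1) → ℕ) (i : Fin (n + 1)) :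
    Commute (dx i : Omega K n) (xMonomial n k) := by
  refine Commute.list_prod_right _ _ fun a ha => ?_
  obtain ⟨j, rfl⟩ := (List.mem_ofFn' _ _).mp ha
  exact (show Commute (dx i : Omega K n) (x j) from (x_dx_comm j i).symm).pow_right _

theorem xMonomial_mem (k : Fin (n + 1) → ℕ) : xMonomial n k ∈ degreePart K n 0 := by
  refine SetLike.GradeZero.subring (degreePart K n) |>.list_prod_mem fun a ha => ?_
  obtain ⟨j, rfl⟩ := (List.mem_ofFn' _ _).mp ha
  exact (SetLike.GradeZero.subring (degreePart K n)).pow_mem (x_mem j) _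

theorem dx_zero_eq : (dx 0 : Omega K n) = -∑ i : Fin n, dx i.succ :=
  eq_neg_of_add_eq_zero_left (by rw [← Fin.sum_univ_succ, sum_dx])

/-- Forms are linear combinations of monomials times products of `dx₁, …, dxₙ`. -/
theorem mem_span_xMonomial_mul (η : Omega K n) :
    η ∈ Submodule.span K (Set.range fun a : (Fin (n + 1) → ℕ) × List (Fin n) =>
      (xMonomial n a.1 * (a.2.map fun i => dx i.succ).prod : Omega K n)) := by
  have hd : ∀ (i : Fin n) (η : Omega K n),
      η ∈ Submodule.span K (Set.range fun a : (Fin (n + 1) → ℕ) × List (Fin n) =>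
        (xMonomial n a.1 * (a.2.map fun i => dx i.succ).prod : Omega K n)) →
      dx i.succ * η ∈ Submodule.span K (Set.range fun a : (Fin (n + 1) → ℕ) × List (Fin n) =>
        (xMonomial n a.1 * (a.2.map fun i => dx i.succ).prod : Omega K n)) := by
    intro i η h
    induction h using Submodule.span_induction with
    | mem η h =>
      obtain ⟨⟨k, l⟩, rfl⟩ := h
      refine Submodule.subset_span ⟨(k, i :: l), ?_⟩
      simp only [List.map_cons, List.prod_cons]
      rw [← mul_assoc, ← mul_assoc, (commute_dx_xMonomial k i.succ).eq]
    | zero => simp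
    | add a b _ _ ha hb => rw [mul_add]; exact Submodule.add_mem _ ha hb
    | smul c a _ ha => rw [mul_smul_comm]; exact Submodule.smul_mem _ _ ha
  induction η using omega_induction with
  | one => exact Submodule.subset_span ⟨(0, []), by simp [xMonomial]⟩
  | x_mul i η h =>
    induction h using Submodule.span_induction with
    | mem η h =>
      obtain ⟨⟨k, l⟩, rfl⟩ := h
      exact Submodule.subset_span ⟨(_, l), by rw [← mul_assoc, x_mul_xMonomial]⟩
    | zero => simp
    | add a b _ _ ha hb => rw [mul_add]; exact Submodule.add_mem _ ha hb
    | smul c a _ ha => rw [mul_smul_comm]; exact Submodule.smul_mem _ _ ha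
  | dx_mul i η h =>
    cases i using Fin.cases with
    | zero =>
      -- Only dx₀ is eliminated. Keeping x₀ makes the spanning family redundant, but its top-degree
      -- members then have the shape of the integration formula.
      rw [dx_zero_eq, neg_mul, Finset.sum_mul]
      exact Submodule.neg_mem _ (Submodule.sum_mem _ fun i _ => hd i η h)
    | succ i => exact hd i η h
  | add a b ha hb => exact Submodule.add_mem _ ha hb
  | smul c a ha => exact Submodule.smul_mem _ _ ha

variable (K n) in
/-- The linear combinations of `dx₁, …, dxₙ`. -/
def dxComb : (Fin n → K) →ₗ[K] Omega K n :=
  Fintype.linearCombination K fun i => dx i.succ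

/-- Anticommutativity makes the square equal to its own negative, and 2 is invertible. This allows
the dxᵢ to be extended to the exterior algebra. -/
theorem dxComb_mul_self [CharZero K] (v : Fin n → K) : dxComb K n v * dxComb K n v = 0 := by
  have h : dxComb K n v * dxComb K n v = -(dxComb K n v * dxComb K n v) := by
    rw [dxComb, Fintype.linearCombination_apply, Finset.sum_mul_sum, ← Finset.sum_neg_distrib]
    conv_lhs => rw [Finset.sum_comm]
    refine Finset.sum_congr rfl fun a _ => ?_
    rw [← Finset.sum_neg_distrib]
    refine Finset.sum_congr rfl fun b _ => ?_
    rw [smul_mul_smul_comm, smul_mul_smul_comm, dx_anticomm, smul_neg, mul_comm]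
  have h2 : (2 : K) • (dxComb K n v * dxComb K n v) = 0 := by
    rw [two_smul]
    exact eq_neg_iff_add_eq_zero.mp h
  exact (smul_eq_zero.mp h2).resolve_left two_ne_zero

/-- A functional on forms which vanishes on `x₀^k₀ ⋯ xₙ^kₙ dx₁ ∧ ⋯ ∧ dxₙ` vanishes on the products
of the same monomial with any `n` of the `dxᵢ`. -/
theorem apply_xMonomial_mul_eq_zero [CharZero K] (Φ : Omega K n →ₗ[K] K) (k : Fin (n + 1) → ℕ)
    (h : Φ (xMonomial n k * (List.ofFn fun j : Fin n => dx j.succ).prod) = 0) (c : Fin n → Fin n) :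
    Φ (xMonomial n k * (List.ofFn fun j : Fin n => dx (c j).succ).prod) = 0 := by
  let L : ExteriorAlgebra K (Fin n → K) →ₐ[K] Omega K n :=
    ExteriorAlgebra.lift K ⟨dxComb K n, dxComb_mul_self⟩
  let A : (Fin n → K) [⋀^Fin n]→ₗ[K] K :=
    (Φ ∘ₗ LinearMap.mulLeft K (xMonomial n k) ∘ₗ L.toLinearMap).compAlternatingMap
      (ExteriorAlgebra.ιMulti K n)
  have hA : ∀ c : Fin n → Fin n, A (fun j => Pi.single (c j) 1) =
      Φ (xMonomial n k * (List.ofFn fun j : Fin n => dx (c j).succ).prod) := by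
    intro c
    change Φ (xMonomial n k * L (ExteriorAlgebra.ιMulti K n fun j => Pi.single (c j) 1)) = _
    rw [ExteriorAlgebra.ιMulti_apply, map_list_prod, List.map_ofFn]
    congr 4
    funext j
    simp [L, dxComb, Fintype.linearCombination_apply, Pi.single_apply]
  have hb : A (Pi.basisFun K (Fin n)) = 0 := by
    rw [← h, ← hA fun j => j]
    congr 1
    funext j
    simp
  -- An alternating n-linear form on Kⁿ is its value on the standard basis times the determinant,
  -- and that value is zero by hypothesis.
  rw [← hA, A.eq_smul_basis_det (Pi.basisFun K (Fin n)), hb]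
  simp

/-- A functional on `n`-forms is determined by its values on `x₀^k₀ ⋯ xₙ^kₙ dx₁ ∧ ⋯ ∧ dxₙ`. -/
theorem eq_of_top_degree [CharZero K] {Φ Ψ : Omega K n →ₗ[K] K}
    (hΦ : precScale Φ 2 = (2 : K) ^ n • Φ) (hΨ : precScale Ψ 2 = (2 : K) ^ n • Ψ)
    (h : ∀ k, Φ (xMonomial n k * (List.ofFn fun j : Fin n => dx j.succ).prod) =
      Ψ (xMonomial n k * (List.ofFn fun j : Fin n => dx j.succ).prod)) : Φ = Ψ := by
  ext η
  refine LinearMap.eqOn_span ?_ (mem_span_xMonomial_mul η)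
  rintro _ ⟨⟨k, l⟩, rfl⟩
  by_cases hl : l.length = n
  · obtain ⟨c, rfl⟩ : ∃ c : Fin n → Fin n, List.ofFn c = l :=
      ⟨fun i => l.get (i.cast hl.symm), List.ext_get (by simp [hl]) (by simp)⟩
    have h0 := apply_xMonomial_mul_eq_zero (Φ - Ψ) k (by simp [h]) c
    simp only [List.map_ofFn]
    exact sub_eq_zero.mp h0
  · have hd : (l.map fun i => (dx i.succ : Omega K n)).prod ∈ degreePart K n l.length := by
      refine Submodule.subset_span ⟨l.map fun i => .inr i.succ, ?_, ?_⟩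
      · simp [List.countP_map, Function.comp_def]
      · rw [List.map_map]; rfl
    have hm : (xMonomial n k * (l.map fun i => dx i.succ).prod : Omega K n) ∈
        degreePart K n l.length := by
      simpa using SetLike.GradedMul.mul_mem (xMonomial_mem k) hd
    have hz : ∀ Θ : Omega K n →ₗ[K] K, precScale Θ 2 = (2 : K) ^ n • Θ →
        Θ (xMonomial n k * (l.map fun i => dx i.succ).prod) = 0 := by
      intro Θ hΘ
      -- The weight condition encodes vanishing outside degree n: on l-forms it gives (2^l - 2^n) Θ
      -- = 0, and 2^l ≠ 2^n in characteristic zero when l ≠ n.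
      have e := DFunLike.congr_fun hΘ (xMonomial n k * (l.map fun i => dx i.succ).prod)
      rw [precScale_apply, scale_of_mem _ hm, map_smul, LinearMap.smul_apply, smul_eq_mul,
        smul_eq_mul, ← sub_eq_zero, ← sub_mul] at e
      refine (mul_eq_zero.mp e).resolve_left fun e => hl ?_
      have : (2 : ℕ) ^ l.length = 2 ^ n := by exact_mod_cast sub_eq_zero.mp e
      exact Nat.pow_right_injective le_rfl this
    exact (hz Φ hΦ).trans (hz Ψ hΨ).symm

/-! ### Homogeneity of the integrals and the beta integral -/

theorem precScale_integral (c : K) : precScale (integral K n) c = c ^ n • integral K n := by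
  refine linearMap_ext_word fun w => ?_
  rw [precScale_apply, scale_of_mem c (word_mem w), map_smul, LinearMap.smul_apply]
  by_cases h : w.countP Sum.isRight = n
  · rw [h]
  · rw [integral_eq_zero h (word_mem w), smul_zero, smul_zero]

variable (K) in
/-- The integral over `0 ≤ s ≤ 1` of a form on the `1`-simplex with coordinates `(s, 1 - s)`. -/
def dsIntegral : Omega K 1 →ₗ[K] K := unitIntegral K ∘ₗ dsCoeff K

/-- The coefficient of ds has weight one and the constant part weight zero. Both are proved together
because the ε-part of a product involves both parts of its factors. -/
theorem intervalChart_fst_snd_scale (c : K) (ω : Omega K 1) :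
    (intervalChart K (scale c ω)).fst = (intervalChart K ω).fst ∧
      (intervalChart K (scale c ω)).snd = c • (intervalChart K ω).snd := by
  have hx : ∀ i, (intervalChart K (x i)).snd = 0 := by
    intro i
    rw [intervalChart, lift_x]
    fin_cases i <;> simp
  have hdx : ∀ i, (intervalChart K (dx i)).fst = 0 := by
    intro i
    rw [intervalChart, lift_dx]
    fin_cases i <;> simp
  induction ω using omega_induction with
  | one => simp
  | x_mul i η h =>
    rw [map_mul, map_mul, map_mul, scale_x]
    simp [h.1, h.2, hx]
  | dx_mul i η h =>
    rw [map_mul, map_mul, map_mul, scale_dx, map_smul]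
    simp [h.1, h.2, hdx]
  | add a b ha hb => simp [ha.1, ha.2, hb.1, hb.2]
  | smul r a ha => simp [ha.1, ha.2, smul_comm r c]

theorem precScale_dsIntegral (c : K) : precScale (dsIntegral K) c = c • dsIntegral K := by
  ext ω
  change unitIntegral K (intervalChart K (scale c ω)).snd =
    c • unitIntegral K (intervalChart K ω).snd
  rw [(intervalChart_fst_snd_scale c ω).2, map_smul]

theorem unitIntegral_X_pow (a : ℕ) : unitIntegral K (Polynomial.X ^ a) = 1 / ((a : K) + 1) := by
  have h := (Polynomial.basisMonomials K).constr_basis K (fun k : ℕ => 1 / ((k : K) + 1)) a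
  simp only [Polynomial.coe_basisMonomials, Polynomial.monomial_one_right_eq_X_pow] at h
  exact h

/-- The beta integral. -/
theorem unitIntegral_X_pow_mul [CharZero K] (a b : ℕ) :
    unitIntegral K (Polynomial.X ^ a * (1 - Polynomial.X) ^ b) =
      (a.factorial * b.factorial : K) / ((a + b + 1).factorial : K) := by
  induction b generalizing a with
  | zero =>
    have h1 : (a : K) + 1 ≠ 0 := Nat.cast_add_one_ne_zero _
    have h0 : (a.factorial : K) ≠ 0 := by exact_mod_cast Nat.factorial_ne_zero _
    simp only [pow_zero, mul_one, unitIntegral_X_pow, add_zero, Nat.factorial_succ,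
      Nat.factorial_zero]
    push_cast
    field_simp
  | succ b ih =>
    -- One factor 1 - s is expanded, which lowers b but raises a in one term; hence the induction on
    -- b for all a.
    have e : (Polynomial.X ^ a * (1 - Polynomial.X) ^ (b + 1) : Polynomial K) =
        Polynomial.X ^ a * (1 - Polynomial.X) ^ b -
          Polynomial.X ^ (a + 1) * (1 - Polynomial.X) ^ b := by ring
    rw [e, map_sub, ih, ih, show a + 1 + b + 1 = (a + b + 1) + 1 by ring,
      show a + (b + 1) + 1 = (a + b + 1) + 1 by ring]
    have h0 : ((a + b + 1).factorial : K) ≠ 0 := by exact_mod_cast Nat.factorial_ne_zero _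
    have h1 : ((a + b + 1 : ℕ) : K) + 1 ≠ 0 := Nat.cast_add_one_ne_zero _
    simp only [Nat.factorial_succ (a + b + 1), Nat.factorial_succ a, Nat.factorial_succ b]
    push_cast at h1 ⊢
    field_simp
    ring

/-- The factors stand in the order in which the cone computation produces them: s comes from the
cone vertex, while the powers of t = 1 - s come from the coordinates t y_b and from their
differentials. -/
theorem dsIntegral_monomial [CharZero K] (a b c d : ℕ) :
    dsIntegral K (x 1 ^ a * (x 0 ^ b * (x 1 ^ c * (dx 0 * x 1 ^ d)))) =
      (b.factorial * (a + c + d).factorial : K) / ((b + (a + c + d) + 1).factorial : K) := by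
  rw [← unitIntegral_X_pow_mul]
  change unitIntegral K (intervalChart K _).snd = _
  congr 1
  have h0 : intervalChart K (x 0) = TrivSqZeroExt.inl Polynomial.X := lift_x _ _ _ _ _ _ _ _
  have h1 : intervalChart K (x 1) = TrivSqZeroExt.inl (1 - Polynomial.X) := lift_x _ _ _ _ _ _ _ _
  have h2 : intervalChart K (dx 0) = TrivSqZeroExt.inr 1 := lift_dx _ _ _ _ _ _ _ _
  simp only [map_mul, map_pow, h0, h1, h2, TrivSqZeroExt.inl_pow, TrivSqZeroExt.inl_mul_inr,
    TrivSqZeroExt.inr_mul_inl, TrivSqZeroExt.snd_inr, smul_eq_mul, MulOpposite.smul_eq_mul_unop,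
    MulOpposite.unop_op]
  ring

/-! ### Integration over a simplex through its cone structure -/

theorem precMul_coneFunctional_x_same_pow (v : Fin (N + 2)) (φ : Omega K 1 →ₗ[K] K)
    (ψ : Omega K N →ₗ[K] K) (k : ℕ) :
    precMul (coneFunctional v φ ψ) (x v ^ k) = coneFunctional v (precMul φ (x 0 ^ k)) ψ := by
  induction k generalizing φ with
  | zero => ext ω; simp [coneFunctional_apply, precMul]
  | succ k ih =>
    rw [pow_succ', ← precMul_precMul, precMul_coneFunctional_x_same, ih, precMul_precMul, pow_succ']

theorem precMul_one (φ : Omega K n →ₗ[K] K) : precMul φ 1 = φ := by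
  ext ω
  simp

theorem precMul_coneFunctional_x_pow (v : Fin (N + 2)) (b : Fin (N + 1)) (φ : Omega K 1 →ₗ[K] K)
    (ψ : Omega K N →ₗ[K] K) (k : ℕ) :
    precMul (coneFunctional v φ ψ) (x (v.succAbove b) ^ k) =
      coneFunctional v (precMul φ (x 1 ^ k)) (precMul ψ (x b ^ k)) := by
  induction k generalizing φ ψ with
  | zero => simp [precMul_one]
  | succ k ih =>
    rw [pow_succ', ← precMul_precMul, precMul_coneFunctional_x, ih, precMul_precMul,
      precMul_precMul, pow_succ', pow_succ']

theorem precMul_coneFunctional_prod_x_pow (v : Fin (N + 2)) {l : ℕ} (c : Fin l → Fin (N + 1))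
    (φ : Omega K 1 →ₗ[K] K) (ψ : Omega K N →ₗ[K] K) (k : Fin l → ℕ) :
    precMul (coneFunctional v φ ψ) (List.ofFn fun i => x (v.succAbove (c i)) ^ k i).prod =
      coneFunctional v (precMul φ (x 1 ^ ∑ i, k i))
        (precMul ψ (List.ofFn fun i => x (c i) ^ k i).prod) := by
  induction l generalizing φ ψ with
  | zero => simp [precMul_one]
  | succ l ih =>
    rw [List.ofFn_succ, List.prod_cons, ← precMul_precMul, precMul_coneFunctional_x_pow,
      ih (fun i => c i.succ) _ _ (fun i => k i.succ), precMul_precMul, precMul_precMul,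
      Fin.sum_univ_succ, pow_add, List.ofFn_succ, List.prod_cons]

theorem coneFunctional_zero (v : Fin (N + 2)) (ψ : Omega K N →ₗ[K] K) :
    coneFunctional v 0 ψ = 0 := by
  have h := joinContract_smul (m := N + 1) ![some v, none] (0 : K) 0
  rw [zero_smul, zero_smul] at h
  ext ω
  simp [coneFunctional_apply, h]

/-- If φ kills multiples of dt, each d(t y_b) contributes only t dy_b, so l differentials give t^l.
The signs from crossing disappear because φ is finally evaluated on a 0-form. -/
theorem coneFunctional_prod_dx (v : Fin (N + 2)) {l : ℕ} (c : Fin l → Fin (N + 1))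
    (φ : Omega K 1 →ₗ[K] K) (ψ : Omega K N →ₗ[K] K) (hφ : precMul φ (dx 1) = 0) :
    coneFunctional v φ ψ (List.ofFn fun i => dx (v.succAbove (c i))).prod =
      φ (x 1 ^ l) * ψ (List.ofFn fun i => dx (c i)).prod := by
  induction l generalizing φ ψ with
  | zero => simp [coneFunctional_one]
  | succ l ih =>
    have hφ' : precMul (precScale (precMul φ (x 1)) (-1)) (dx 1) = 0 := by
      rw [precScale_precMul_dx, precMul_precMul, x_dx_comm, ← precMul_precMul, hφ]
      ext ω
      simp
    rw [List.ofFn_succ, List.prod_cons, ← precMul_apply, precMul_coneFunctional_dx, hφ,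
      coneFunctional_zero, zero_add, ih (fun i => c i.succ) _ _ hφ', List.ofFn_succ,
      List.prod_cons]
    simp [scale_x, pow_succ']

/-- Integration over the simplex by means of its cone structure with respect to the vertex `e₁`. -/
theorem coneFunctional_integral [CharZero K] :
    coneFunctional 1 (dsIntegral K) (integral K N) = integral K (N + 1) := by
  refine eq_of_top_degree ?_ (precScale_integral 2) fun k => ?_
  · rw [precScale_coneFunctional, precScale_dsIntegral, precScale_integral]
    ext ω
    simp only [coneFunctional_apply, joinContract_smul, LinearMap.smul_apply, map_smul,
      smul_eq_mul, pow_succ]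
    ring
  -- Here dt = -ds, so ds ∧ dt = 0: once ds is used, every dt term drops out.
  · have hd : (dx 0 * dx 1 : Omega K 1) = 0 := by
      have h : (dx 0 + dx 1 : Omega K 1) = 0 := by
        simpa [Fin.sum_univ_succ] using sum_dx (K := K) (n := 1)
      rw [← neg_eq_of_add_eq_zero_right h, mul_neg, dx_mul_self, neg_zero]
    have h0 : (1 : Fin (N + 2)).succAbove 0 = 0 := by simp
    have hs : ∀ b : Fin N, (1 : Fin (N + 2)).succAbove b.succ = b.succ.succ := by
      intro b
      rw [← Fin.succ_zero_eq_one, Fin.succ_succAbove_succ]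
      simp
    have hR := integral_monomial (K := K) k 0
    simp only [Fin.zero_succAbove, Fin.val_zero, pow_zero, one_mul] at hR
    -- The face opposite to e₁ has vertices e₀, e₂, …, so the exponent `k 1` is skipped. On both
    -- simplices the omitted differential is dx₀, hence no sign appears.
    have hI := integral_monomial (K := K) (Fin.cons (k 0) fun b : Fin N => k b.succ.succ) 0
    simp only [Fin.zero_succAbove, Fin.val_zero, pow_zero, one_mul, List.ofFn_succ, Fin.cons_zero,
      Fin.cons_succ, Fin.sum_univ_succ, Fin.prod_univ_succ, List.prod_cons] at hI
    -- With cone vertex e₁, the leading differential dx₁ of the top form is ds, already in front.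
    -- The factors are fed to the functional from left to right.
    rw [xMonomial, hR, List.ofFn_succ, List.ofFn_succ, List.prod_cons, List.prod_cons,
      List.ofFn_succ, List.prod_cons, Fin.succ_zero_eq_one, mul_assoc, mul_assoc,
      ← precMul_apply, ← precMul_apply (precMul _ _), ← precMul_apply (precMul (precMul _ _) _),
      ← precMul_apply (precMul (precMul (precMul _ _) _) _)]
    nth_rewrite 1 [← h0]
    simp only [← hs]
    rw [precMul_coneFunctional_x_pow, precMul_coneFunctional_x_same_pow,
      precMul_coneFunctional_prod_x_pow, precMul_coneFunctional_dx_same, coneFunctional_prod_dx]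
    · simp only [precMul_apply, hs]
      -- The beta integral has numerator factor (k₀ + k₂ + ⋯ + N)!, which cancels the denominator of
      -- the integral over the face.
      rw [← mul_assoc (x 0 ^ k 0), hI, dsIntegral_monomial, Fin.sum_univ_succ, Fin.sum_univ_succ,
        Fin.prod_univ_succ, Fin.prod_univ_succ]
      have e : k 1 + (k 0 + ∑ i : Fin N, k i.succ.succ + N) + 1 =
        k 0 + (k 1 + ∑ i : Fin N, k i.succ.succ) + (N + 1) := by ring
      rw [e, Fin.succ_zero_eq_one]
      have hne : ((k 0 + ∑ i : Fin N, k i.succ.succ + N).factorial : K) ≠ 0 := by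
        exact_mod_cast Nat.factorial_ne_zero _
      have hne' : ((k 0 + (k 1 + ∑ i : Fin N, k i.succ.succ) + (N + 1)).factorial : K) ≠ 0 := by
        exact_mod_cast Nat.factorial_ne_zero _
      field_simp
    · ext ω
      simp only [precMul_apply, LinearMap.zero_apply]
      rw [← mul_assoc (dx 0), hd]
      simp

/-! ### Comparison of the two operators -/

theorem dupontVertex_eq_joinContract (j : Fin (m + 1)) :
    dupontVertex K j = joinContract ![some j, none] (dsIntegral K) := by
  have : (TensorProduct.lid K (Omega K m)).toLinearMap ∘ₗ
      TensorProduct.map (unitIntegral K) LinearMap.id ∘ₗ alphaPart K m =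
        contractLeft (dsIntegral K) :=
    prodForms_ext fun p a b _ => rfl
  rw [joinContract, ← this]
  rfl

/-- The top coefficient of 1 is the determinant of the empty matrix. This normalizes the base case,
where the contraction over a point is the identity. -/
theorem integral_zero_one : integral K 0 1 = 1 := by
  have h : integral K 0 1 = polyIntegral K 0 (topCoeff K 0 1) := by
    change polyIntegral K 0 (topCoeff K 0 (chart K 0 1)) = _
    rw [map_one]
  have h1 : topCoeff K 0 1 = 1 := by
    have := ExteriorAlgebra.liftAlternating_apply_ιMulti (R := MvPolynomial (Fin 0) K)
      (n := 0) (Pi.single 0 Matrix.detRowAlternating : ∀ i,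
        (Fin 0 → MvPolynomial (Fin 0) K) [⋀^Fin i]→ₗ[_] MvPolynomial (Fin 0) K) Fin.elim0
    rw [ExteriorAlgebra.ιMulti_zero_apply, Pi.single_eq_same] at this
    exact this.trans (Matrix.det_isEmpty)
  rw [h, h1, ← map_one MvPolynomial.C, ← MvPolynomial.monomial_zero', polyIntegral_monomial]
  simp

/-- For any sequence of vertices, Manetti's operator is a composition of Dupont's operators. -/
theorem joinContract_integral_eq_prod [CharZero K] (J : Fin n → Fin (m + 1)) :
    joinContract (Fin.cons none fun i => some (J i)) (integral K n) =
      (List.ofFn fun i => (dupontVertex K (J i) : Module.End K (Omega K m))).reverse.prod := by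
  induction n with
  | zero =>
    refine LinearMap.ext fun η => ?_
    rw [joinContract_none _ _ rfl, integral_zero_one, one_smul]
    rfl
  | succ n ih =>
    -- The operator of `J 0` acts first, so it is the rightmost factor; the induction hypothesis
    -- handles the remaining vertices.
    rw [List.ofFn_succ, List.reverse_cons, List.prod_append, List.prod_singleton,
      ← ih fun i => J i.succ]
    refine LinearMap.ext fun η => ?_
    -- The vertex `J 0` is inserted at position 1, since position 0 belongs to the moving point v
    -- with coordinate s in Manetti's ordering (s, t₀, t₁, …).
    rw [Module.End.mul_apply, dupontVertex_eq_joinContract, joinContract_joinContract_cone 1,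
      coneFunctional_integral]
    congr 2
    funext a
    cases a using Fin.cases with
    | zero => exact (Fin.insertNth_apply_succAbove (α := fun _ => Option (Fin (m + 1))) 1 (some (J 0))
        (Fin.cons none fun i : Fin n => some (J i.succ)) 0).symm
    | succ a =>
      cases a using Fin.cases with
      | zero => exact (Fin.insertNth_apply_same (α := fun _ => Option (Fin (m + 1))) 1 (some (J 0))
          (Fin.cons none fun i : Fin n => some (J i.succ))).symm
      | succ a =>
        have h := Fin.insertNth_apply_succAbove (α := fun _ => Option (Fin (m + 1))) 1 (some (J 0))
          (Fin.cons none fun i : Fin n => some (J i.succ)) a.succ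
        rw [← Fin.succ_zero_eq_one, Fin.succ_succAbove_succ, Fin.zero_succAbove] at h
        exact h.symm

theorem manettiFace_eq_dupontFace [CharZero K] (f : Fin (n + 1) ↪o Fin (m + 1)) :
    manettiFace K f = dupontFace K f :=
  joinContract_integral_eq_prod fun i => f i

end SimplexForms

end

/-- Manetti's operator and Dupont's operator on polynomial differential forms coincide. -/
theorem theorem4p1 (K : Type*) [Field K] [CharZero K] (m : ℕ) :
    SimplexForms.manettiOp K m = SimplexForms.dupontOp K m := by
  simp only [SimplexForms.manettiOp, SimplexForms.dupontOp, SimplexForms.manettiFace_eq_dupontFace]
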